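/- **Model.** Let $\varepsilon\in(0,1)$ and let $n,N,u,m$ be non-negative integers. A data structure over the universe $U=\{1,\dots,u\}$ with $m$ bits of space has memory states in $\{0,1\}^m$ and an infinite read-only tape of independent fair random bits, which is not counted as space. It has an initial state and procedures Insert, Delete and Query; these depend (measurably) on the tape, and the last three also on the current memory state and the input key only. Query does not change the memory. A sequence of insertions and deletions is *self-contained* if it can be validly performed starting from the empty key set, i.e. a key is inserted only when it is absent and deleted only when it is present. A sequence is *admissible* if it is self-contained, has at most $N$ operations, and the key set $S$ never contains more than $n$ keys. The data structure is a *dynamic filter with universe $U$, capacity $n$ and false-positive error rate $\varepsilon$ that supports $N$ operations* if, after every admissible sequence (fixed independently of the tape) performed from the initial state, Query$(x)$ returns true for every tape if $x\in S$, and returns false with probability at least $1-\varepsilon$ over the tape if $x\in U\setminus S$. The *accepted set* of a filter state (for a given tape) is the set of keys $x\in U$ for which Query$(x)$ returns true. The filter is *monotone* if for all $0<j<k$, every admissible sequence $\sigma(1),\dots,\sigma(k)$ whose suffix $\sigma(j+1),\dots,\sigma(k)$ is self-contained, and every tape, the accepted set after $\sigma(1),\dots,\sigma(j)$ is contained in the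 accepted set after $\sigma(1),\dots,\sigma(k)$. The memory state is allowed to depend on the whole history of operations. **Proposition.** Let $\varepsilon=\varepsilon(n)\in(0,1)$, $u=u(n)\in\mathbb N$ and $N=N(n)\in\mathbb N$ satisfy $\varepsilon=o(1)$, $u=\omega(n\varepsilon^{-1})$ and $N=\omega(n)$ as $n\to\infty$. Then there is a function $g(n)=o(n)$, depending only on the functions $\varepsilon,u,N$, such that for every $n$, every monotone dynamic filter with a universe of size $u(n)$, capacity $n$ and false-positive error rate $\varepsilon(n)$ that supports $N(n)$ insertions and deletions uses at least $$n\log_2\varepsilon(n)^{-1}+n\log_2 e-g(n)$$ bits of space. -/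

import Mathlib

open Filter Asymptotics MeasureTheory

namespace DynamicFilter

/-- An operation that updates the key set of a filter over the universe `U`. -/
inductive Op (U : Type*) where
  | ins (x : U)
  | del (x : U)

section Sequences

variable {U : Type*} [DecidableEq U]

/-- The effect of one operation on the true key set. -/
def Op.updateKeys (S : Finset U) : Op U → Finset U
  | .ins x => insert x S
  | .del x => S.erase x

/-- The true key set after performing `σ` on the empty filter. -/
def keySet (σ : List (Op U)) : Finset U :=
  σ.foldl Op.updateKeys ∅

/-- `σ` can be performed when the true key set is `S`: a key is inserted only while it is absent,
and deleted only while it is present. -/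
def ValidFrom (S : Finset U) : List (Op U) → Prop
  | [] => True
  | .ins x :: σ => x ∉ S ∧ ValidFrom (insert x S) σ
  | .del x :: σ => x ∈ S ∧ ValidFrom (S.erase x) σ

/-- Self-contained operational sequences: those that are valid on an empty filter. -/
def SelfContained (σ : List (Op U)) : Prop :=
  ValidFrom ∅ σ

/-- The sequences that a filter of capacity `n` supporting `N` operations has to handle: valid
sequences on the empty filter, of at most `N` insertions and deletions, along which the true key
set never has more than `n` elements. -/
def Admissible (n N : ℕ) (σ : List (Op U)) : Prop :=
  SelfContained σ ∧ σ.length ≤ N ∧ ∀ τ : List (Op U), τ <+: σ → (keySet τ).card ≤ n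

end Sequences

/-- The infinite read-only random tape. -/
abbrev Tape : Type := ℕ → Bool

/-- The law of the tape: independent fair bits. -/
noncomputable def tapeLaw : Measure Tape :=
  Measure.infinitePi fun _ : ℕ => (PMF.uniformOfFintype Bool).toMeasure

/-- The states of a memory of fixed length, consisting of `m` bits. -/
abbrev Memory (m : ℕ) : Type := Fin m → Bool

/-- A randomized data structure over the universe `U` using `m` bits of memory. Each operation
sees only the random tape, the memory and the input key, and is a measurable function of the
tape. -/
structure Algorithm (U : Type*) (m : ℕ) where
  start : Tape → Memory m
  ins : Tape → Memory m → U → Memory m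
  del : Tape → Memory m → U → Memory m
  query : Tape → Memory m → U → Bool
  measurable_start : Measurable start
  measurable_ins : ∀ s x, Measurable fun t => ins t s x
  measurable_del : ∀ s x, Measurable fun t => del t s x
  measurable_query : ∀ s x, Measurable fun t => query t s x

namespace Algorithm

variable {U : Type*} {m : ℕ}

/-- One update of the memory, with random tape `t`. -/
def step (D : Algorithm U m) (t : Tape) (s : Memory m) : Op U → Memory m
  | .ins x => D.ins t s x
  | .del x => D.del t s x

/-- The memory state after performing `σ` on the initial state, with random tape `t`. -/
def run (D : Algorithm U m) (t : Tape) (σ : List (Op U)) : Memory m :=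
  σ.foldl (D.step t) (D.start t)

/-- The accepted set of the filter state reached by `σ`, with random tape `t`. -/
def accepted (D : Algorithm U m) (t : Tape) (σ : List (Op U)) : Set U :=
  {x | D.query t (D.run t σ) x = true}

variable [DecidableEq U]

/-- `D` implements a dynamic filter of capacity `n` and false-positive error rate `ε`, supporting
sequences of `N` insertions and deletions. The operational sequence and the queried key are fixed
independently of the random tape. -/
structure IsDynamicFilter (D : Algorithm U m) (n : ℕ) (ε : ℝ) (N : ℕ) : Prop where
  query_mem : ∀ σ : List (Op U), Admissible n N σ → ∀ x ∈ keySet σ, ∀ t : Tape,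
    D.query t (D.run t σ) x = true
  query_not_mem : ∀ σ : List (Op U), Admissible n N σ → ∀ x ∉ keySet σ,
    1 - ε ≤ tapeLaw.real {t : Tape | D.query t (D.run t σ) x = false}

/-- Monotonicity: for every nonempty operational sequence `τ` that is continued by a nonempty
self-contained sequence `ρ`, the accepted set after `τ` is contained in the one after `τ ++ ρ`.
Only sequences that the filter supports are considered. -/
def IsMonotone (D : Algorithm U m) (n N : ℕ) : Prop :=
  ∀ τ ρ : List (Op U), τ ≠ [] → ρ ≠ [] → Admissible n N (τ ++ ρ) → SelfContained ρ →
    ∀ t : Tape, D.accepted t τ ⊆ D.accepted t (τ ++ ρ)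

end Algorithm

end DynamicFilter

/-!
The keys inserted into a monotone filter can be decoded from its memory, and the lower bound is the
information that this decoding needs.

Let `W = n + ε u` bound the mean size of an accepted set, and let `F i` be the mean size of the
accepted set when `i / k` of the capacity is in use, for a large constant `k`. The keys come in `k`
blocks, and a block is inserted at each level `i < k`. If `F` were linear, then the keys could be
decoded one block after the other: after the known blocks have been deleted from the memory, the
accepted set has only `(i / k) W` elements, and it contains the unknown keys. This costs
`log₂ n! + n log₂ (W / n)` instead of `n log₂ u` bits, which is the claim. In general the decoder
also knows a set that is unlikely to contain the unknown keys. If the unknown blocks are those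
between the levels `a` and `a'`, then the blocks above `a'` can be deleted, and the state at level
`a`, before any unknown block was inserted, can be recomputed. By monotonicity the accepted set of
the latter state is contained in that of the former, so that the unknown keys lie in a difference
of two sets, of mean size `F a' - F a` (`Scheme`, `Scheme.exists_predicts_hidden`). The decoder
chooses whether to decode the first or the last unknown block next. Some order of this kind is at
least as good as it would be for a linear `F` (`shrinkCost_le`).

For this, the accepted set after the deletion of the blocks above `a'` must not be much larger than
the accepted set when level `a'` was left. To this end the blocks are inserted within `k` nested
loops, each of which inserts a fresh block, performs the inner loops and deletes the block, `R`
times. At each level the accepted set only grows from one iteration to the next, so that some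
iteration enlarges it by at most `W / R` on average; the execution is stopped in these iterations
(`Samples.exists_schedule`). The decoder does not just delete the known blocks: it completes the
loops, and so it arrives exactly at the end of that iteration (`Schedule.top_append_down`). The
loops need `O(n)` operations for constant `k` and `R`, which `N = ω(n)` permits.

A decoder that assigns a subprobability to the keys for each memory state has a mean logarithmic
loss of at least the logarithm of the number of key assignments minus `m log 2` (`Scheme.Predicts.le`).
The tape is dealt with by averaging over finitely many representative tapes. The explicit bound is
`log_card_le`; the rest is asymptotics.
-/

namespace DynamicFilter

/-! ### Shrinking an interval from its ends -/

/-- The logarithm of the mean slope of `G` on the `l` unit steps that start at `a`. -/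
noncomputable def logSlope (G : ℕ → ℝ) (l a : ℕ) : ℝ :=
  Real.log ((G (a + l) - G a) / l)

/-- The least sum of `logSlope` over a chain of intervals that starts with `[a, a + l]` and in
which each interval arises from the previous one by dropping the first or the last unit step. -/
noncomputable def shrinkCost (G : ℕ → ℝ) : ℕ → ℕ → ℝ
  | 0, _ => 0
  | l + 1, a => logSlope G (l + 1) a + min (shrinkCost G l a) (shrinkCost G l (a + 1))

lemma shrinkCost_succ_le_left (G : ℕ → ℝ) (l a : ℕ) :
    shrinkCost G (l + 1) a ≤ logSlope G (l + 1) a + shrinkCost G l a := by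
  rw [shrinkCost]; gcongr; exact min_le_left _ _

lemma shrinkCost_succ_le_right (G : ℕ → ℝ) (l a : ℕ) :
    shrinkCost G (l + 1) a ≤ logSlope G (l + 1) a + shrinkCost G l (a + 1) := by
  rw [shrinkCost]; gcongr; exact min_le_right _ _

lemma shrinkCost_le_drop_last (G : ℕ → ℝ) (a i l : ℕ) :
    shrinkCost G (l + i) a
      ≤ shrinkCost G l a + ∑ j ∈ Finset.range i, logSlope G (l + j + 1) a := by
  induction i with
  | zero => simp
  | succ i ih =>
    rw [Finset.sum_range_succ]
    have := shrinkCost_succ_le_left G (l + i) a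
    rw [← add_assoc]; linarith

lemma shrinkCost_le_drop_first (G : ℕ → ℝ) (e i l : ℕ) :
    shrinkCost G (l + i) e
      ≤ shrinkCost G l (e + i) + ∑ j ∈ Finset.range i, logSlope G (l + j + 1) (e + i - j - 1) := by
  induction i generalizing e with
  | zero => simp
  | succ i ih =>
    rw [Finset.sum_range_succ]
    have h1 := shrinkCost_succ_le_right G (l + i) e
    have h2 := ih (e + 1)
    have h3 : e + (i + 1) - i - 1 = e := by omega
    rw [h3]
    have h4 : e + 1 + i = e + (i + 1) := by omega
    rw [h4] at h2
    rw [← add_assoc]; linarith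

/-- Concavity of the logarithm for the mean slopes of two adjacent intervals. -/
lemma logSlope_superadditive {G : ℕ → ℝ} (hG : StrictMono G) (i j a : ℕ) :
    i * logSlope G i a + j * logSlope G j (a + i) ≤ (i + j : ℕ) * logSlope G (i + j) a := by
  rcases Nat.eq_zero_or_pos i with rfl | hi
  · simp
  rcases Nat.eq_zero_or_pos j with rfl | hj
  · simp
  have hi' : (0 : ℝ) < i := by exact_mod_cast hi
  have hj' : (0 : ℝ) < j := by exact_mod_cast hj
  have hx : 0 < (G (a + i) - G a) / i := div_pos (sub_pos.2 (hG (by omega))) hi'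
  have hy : 0 < (G (a + i + j) - G (a + i)) / j := div_pos (sub_pos.2 (hG (by omega))) hj'
  have h := strictConcaveOn_log_Ioi.concaveOn.2 (Set.mem_Ioi.2 hx) (Set.mem_Ioi.2 hy)
    (show 0 ≤ (i : ℝ) / ((i : ℝ) + (j : ℝ)) by positivity)
    (show 0 ≤ (j : ℝ) / ((i : ℝ) + (j : ℝ)) by positivity) (by field_simp)
  simp only [smul_eq_mul] at h
  have e : (i / (i + j) : ℝ) * ((G (a + i) - G a) / i)
      + j / (i + j) * ((G (a + i + j) - G (a + i)) / j)
      = (G (a + (i + j)) - G a) / ((i + j : ℕ) : ℝ) := by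
    rw [← add_assoc]; push_cast; field_simp; ring
  rw [e] at h
  unfold logSlope
  calc _ = ((i : ℝ) + j) * (i / (i + j) * Real.log ((G (a + i) - G a) / i)
      + j / (i + j) * Real.log ((G (a + i + j) - G (a + i)) / j)) := by field_simp
    _ ≤ _ := by push_cast at h ⊢; gcongr

/-- Summing `f` over the tails of `1, …, n` counts the value at `i` exactly `i` times. -/
lemma sum_range_sum_range_reflect (f : ℕ → ℝ) (n : ℕ) :
    ∑ i ∈ Finset.range n, ∑ j ∈ Finset.range (i + 1), f (n - (i + 1) + j + 1)
      = ∑ i ∈ Finset.range n, (i + 1 : ℕ) * f (i + 1) := by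
  induction n with
  | zero => simp
  | succ n ih =>
    rw [Finset.sum_range_succ', Finset.sum_range_succ _ n, ← ih]
    have : ∀ i ∈ Finset.range n,
        ∑ j ∈ Finset.range (i + 1 + 1), f (n + 1 - (i + 1 + 1) + j + 1)
          = ∑ j ∈ Finset.range (i + 1), f (n - (i + 1) + j + 1) + f (n + 1) := by
      intro i hi
      rw [Finset.sum_range_succ]
      have hi := Finset.mem_range.1 hi
      congr 1
      · refine Finset.sum_congr rfl fun j _ => ?_
        congr 1; omega
      · congr 1; omega
    rw [Finset.sum_congr rfl this, Finset.sum_add_distrib]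
    simp
    ring

/-- Some way of shrinking an interval from its ends is at least as good as it would be for a
linear `G`. For each `i`, the interval of length `n` is split into an end of length `i` and the
rest; concavity and induction bound the cost of the rest, and averaging over `i` and over the two
ends makes the slopes of the ends cancel. -/
theorem shrinkCost_le {G : ℕ → ℝ} (hG : StrictMono G) (n a : ℕ) :
    shrinkCost G n a ≤ n * logSlope G n a := by
  induction n using Nat.strong_induction_on generalizing a with
  | _ n ih =>
  rcases Nat.eq_zero_or_pos n with rfl | hn
  · simp [shrinkCost]
  have hn' : (0 : ℝ) < n := by exact_mod_cast hn
  have key : ∀ i ∈ Finset.range n,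
      ((i + 1 : ℕ) * logSlope G (i + 1) a + (i + 1 : ℕ) * logSlope G (i + 1) (a + n - (i + 1)))
        + 2 * shrinkCost G n a
        - (∑ j ∈ Finset.range (i + 1), logSlope G (n - (i + 1) + j + 1) a
          + ∑ j ∈ Finset.range (i + 1),
              logSlope G (n - (i + 1) + j + 1) (a + n - (n - (i + 1) + j + 1)))
        ≤ 2 * (n * logSlope G n a) := by
    intro i hi
    have hi := Finset.mem_range.1 hi
    obtain ⟨l, rfl⟩ : ∃ l, n = l + (i + 1) := ⟨n - (i + 1), by omega⟩
    have e1 : l + (i + 1) - (i + 1) = l := by omega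
    have e2 : a + (l + (i + 1)) - (i + 1) = a + l := by omega
    rw [e1, e2]
    have c1 := logSlope_superadditive hG (i + 1) l a
    have c2 := logSlope_superadditive hG l (i + 1) a
    rw [add_comm (i + 1) l] at c1
    have i1 := ih l (by omega) (a + (i + 1))
    have i2 := ih l (by omega) a
    have d1 := shrinkCost_le_drop_last G a (i + 1) l
    have d2 := shrinkCost_le_drop_first G a (i + 1) l
    have e3 : ∑ j ∈ Finset.range (i + 1), logSlope G (l + j + 1) (a + (i + 1) - j - 1)
        = ∑ j ∈ Finset.range (i + 1),
            logSlope G (l + j + 1) (a + (l + (i + 1)) - (l + j + 1)) := by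
      refine Finset.sum_congr rfl fun j _ => ?_
      congr 1; omega
    rw [e3] at d2
    linarith
  have hs := Finset.sum_le_sum key
  simp only [Finset.sum_sub_distrib, Finset.sum_add_distrib, Finset.sum_const, Finset.card_range,
    nsmul_eq_mul] at hs
  rw [sum_range_sum_range_reflect (fun i => logSlope G i a) n,
    sum_range_sum_range_reflect (fun i => logSlope G i (a + n - i)) n] at hs
  have : (n : ℝ) * (2 * shrinkCost G n a) ≤ n * (2 * (n * logSlope G n a)) := by linarith
  have := le_of_mul_le_mul_left this hn'
  linarith

/-! ### Valid operational sequences -/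

/-- The key of an operation. -/
def Op.key {V : Type*} : Op V → V
  | .ins x => x
  | .del x => x

/-- Renaming the key of an operation. -/
def Op.map {V W : Type*} (f : V → W) : Op V → Op W
  | .ins x => .ins (f x)
  | .del x => .del (f x)

lemma map_congr_of_key {V W : Type*} {f g : V → W} {w : List (Op V)}
    (h : ∀ o ∈ w, f o.key = g o.key) : w.map (Op.map f) = w.map (Op.map g) := by
  refine List.map_congr_left fun o ho => ?_
  have := h o ho
  cases o <;> simpa [Op.map, Op.key] using this

section Moves

variable {V : Type*} [DecidableEq V]

/-- `Moves c S w T`: the sequence `w` can be performed when the key set is `S`, it leads to the key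
set `T`, and no key set on the way has more than `c` elements. -/
inductive Moves (c : ℕ) : Finset V → List (Op V) → Finset V → Prop
  | nil {S : Finset V} : S.card ≤ c → Moves c S [] S
  | ins {S T : Finset V} {x : V} {w : List (Op V)} :
      S.card ≤ c → x ∉ S → Moves c (insert x S) w T → Moves c S (.ins x :: w) T
  | del {S T : Finset V} {x : V} {w : List (Op V)} :
      S.card ≤ c → x ∈ S → Moves c (S.erase x) w T → Moves c S (.del x :: w) T

namespace Moves

variable {c : ℕ} {S T X : Finset V} {w v : List (Op V)}

lemma append (h : Moves c S w T) (h' : Moves c T v X) : Moves c S (w ++ v) X := by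
  induction h with
  | nil _ => exact h'
  | ins h1 h2 _ ih => exact .ins h1 h2 (ih h')
  | del h1 h2 _ ih => exact .del h1 h2 (ih h')

lemma validFrom (h : Moves c S w T) : ValidFrom S w := by
  induction h with
  | nil _ => trivial
  | ins h1 h2 _ ih => exact ⟨h2, ih⟩
  | del h1 h2 _ ih => exact ⟨h2, ih⟩

lemma foldl_eq (h : Moves c S w T) : w.foldl Op.updateKeys S = T := by
  induction h with
  | nil _ => rfl
  | ins h1 h2 _ ih => exact ih
  | del h1 h2 _ ih => exact ih

lemma card_foldl_le (h : Moves c S w T) :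
    ∀ τ : List (Op V), τ <+: w → (τ.foldl Op.updateKeys S).card ≤ c := by
  induction h with
  | nil h =>
    intro τ hτ
    rw [List.prefix_nil.1 hτ]; exact h
  | ins h1 h2 _ ih =>
    intro τ hτ
    rcases List.prefix_cons_iff.1 hτ with rfl | ⟨t, rfl, ht⟩
    · exact h1
    · exact ih t ht
  | del h1 h2 _ ih =>
    intro τ hτ
    rcases List.prefix_cons_iff.1 hτ with rfl | ⟨t, rfl, ht⟩
    · exact h1
    · exact ih t ht

lemma keySet_eq (h : Moves c ∅ w T) : keySet w = T := h.foldl_eq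

lemma admissible {N : ℕ} (h : Moves c ∅ w T) (hN : w.length ≤ N) : Admissible c N w :=
  ⟨h.validFrom, hN, h.card_foldl_le⟩

end Moves

lemma Moves.map {W : Type*} [DecidableEq W] {c : ℕ} {S T : Finset V} {w : List (Op V)}
    {f : V → W} {A : Set V} (hf : Set.InjOn f A) (h : Moves c S w T) (hS : ↑S ⊆ A)
    (hw : ∀ o ∈ w, o.key ∈ A) :
    Moves c (S.image f) (w.map (Op.map f)) (T.image f) := by
  induction h with
  | nil h => exact .nil (Finset.card_image_le.trans h)
  | @ins S T x w h1 h2 _ ih =>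
    have hx : x ∈ A := hw _ List.mem_cons_self
    refine .ins (Finset.card_image_le.trans h1) ?_ ?_
    · intro hm
      obtain ⟨y, hy, e⟩ := Finset.mem_image.1 hm
      exact h2 (hf (hS hy) hx e ▸ hy)
    · rw [← Finset.image_insert]
      refine ih ?_ fun o ho => hw o (List.mem_cons_of_mem _ ho)
      rw [Finset.coe_insert]
      exact Set.insert_subset hx hS
  | @del S T x w h1 h2 _ ih =>
    have hx : x ∈ A := hS h2
    refine .del (Finset.card_image_le.trans h1) (Finset.mem_image_of_mem _ h2) ?_
    have e : (S.image f).erase (f x) = (S.erase x).image f := by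
      ext y
      simp only [Finset.mem_erase, Finset.mem_image]
      constructor
      · rintro ⟨hne, z, hz, rfl⟩
        exact ⟨z, ⟨fun h => hne (h ▸ rfl), hz⟩, rfl⟩
      · rintro ⟨z, ⟨hne, hz⟩, rfl⟩
        exact ⟨fun h => hne (hf (hS hz) hx h), z, hz, rfl⟩
    rw [e]
    exact ih (fun y hy => hS (Finset.erase_subset _ _ hy))
      fun o ho => hw o (List.mem_cons_of_mem _ ho)

end Moves

/-! ### Nested loops of insertions and deletions

The keys are named by natural numbers, called slots; a sequence over an actual universe arises by
mapping the slots to keys. -/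

/-- Insertion of the `b` slots from `o` on. -/
def insBlock (o b : ℕ) : List (Op ℕ) := (List.range' o b).map Op.ins

/-- Deletion of the `b` slots from `o` on. -/
def delBlock (o b : ℕ) : List (Op ℕ) := (List.range' o b).map Op.del

/-- The number of slots used by `h` nested loops. -/
def slots (b R : ℕ) : ℕ → ℕ
  | 0 => 0
  | h + 1 => R * (b + slots b R h)

/-- `h` nested loops of `R` iterations. Each iteration of a loop inserts a fresh block of `b` keys,
performs the inner loops, and deletes the block. The slots are used in increasing order, starting
with `o`. -/
def loops (b R : ℕ) : ℕ → ℕ → List (Op ℕ)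
  | 0, _ => []
  | h + 1, o => (List.range R).flatMap fun j =>
      insBlock (o + j * (b + slots b R h)) b
        ++ loops b R h (o + j * (b + slots b R h) + b)
        ++ delBlock (o + j * (b + slots b R h)) b

/-- One iteration of the outermost of `h + 1` nested loops. -/
def iteration (b R h o : ℕ) : List (Op ℕ) :=
  insBlock o b ++ loops b R h (o + b) ++ delBlock o b

/-- The iterations number `i, …, i + x - 1` of the outermost of `h + 1` nested loops. -/
def iterations (b R h o i x : ℕ) : List (Op ℕ) :=
  (List.range' i x).flatMap fun j => iteration b R h (o + j * (b + slots b R h))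

lemma iterations_zero (b R h o i : ℕ) : iterations b R h o i 0 = [] := rfl

lemma iterations_add (b R h o i x y : ℕ) :
    iterations b R h o i x ++ iterations b R h o (i + x) y = iterations b R h o i (x + y) := by
  rw [iterations, iterations, iterations, ← List.flatMap_append, List.range'_append_1]

lemma iterations_one (b R h o i : ℕ) :
    iterations b R h o i 1 = iteration b R h (o + i * (b + slots b R h)) := by
  simp [iterations]

lemma loops_succ (b R h o : ℕ) : loops b R (h + 1) o = iterations b R h o 0 R := by
  rw [loops, iterations, List.range_eq_range']; rfl

lemma length_insBlock (o b : ℕ) : (insBlock o b).length = b := by simp [insBlock]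

lemma length_delBlock (o b : ℕ) : (delBlock o b).length = b := by simp [delBlock]

lemma length_loops (b R h o : ℕ) : (loops b R h o).length = 2 * slots b R h := by
  induction h generalizing o with
  | zero => rfl
  | succ h ih =>
    simp [loops, slots, ih, length_insBlock, length_delBlock, List.length_flatMap]
    ring

lemma length_iteration (b R h o : ℕ) :
    (iteration b R h o).length = 2 * (b + slots b R h) := by
  simp [iteration, length_loops, length_insBlock, length_delBlock]; ring

lemma length_iterations (b R h o i x : ℕ) :
    (iterations b R h o i x).length = 2 * (x * (b + slots b R h)) := by
  simp [iterations, length_iteration, List.length_flatMap]; ring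

lemma key_insBlock {o b : ℕ} {p : Op ℕ} (hp : p ∈ insBlock o b) : o ≤ p.key ∧ p.key < o + b := by
  obtain ⟨s, hs, rfl⟩ := List.mem_map.1 hp
  exact List.mem_range'_1.1 hs

lemma key_delBlock {o b : ℕ} {p : Op ℕ} (hp : p ∈ delBlock o b) : o ≤ p.key ∧ p.key < o + b := by
  obtain ⟨s, hs, rfl⟩ := List.mem_map.1 hp
  exact List.mem_range'_1.1 hs

/-- The hypothesis `H` is proved in `key_loops`, by induction over the depth of the loops. -/
lemma key_iteration_of {b R h o : ℕ}
    (H : ∀ o, ∀ p ∈ loops b R h o, o ≤ p.key ∧ p.key < o + slots b R h)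
    {p : Op ℕ} (hp : p ∈ iteration b R h o) :
    o ≤ p.key ∧ p.key < o + (b + slots b R h) := by
  rcases List.mem_append.1 hp with hp | hp
  · rcases List.mem_append.1 hp with hp | hp
    · have := key_insBlock hp; omega
    · have := H _ p hp; omega
  · have := key_delBlock hp; omega

lemma key_iterations_of {b R h o i x : ℕ}
    (H : ∀ o, ∀ p ∈ loops b R h o, o ≤ p.key ∧ p.key < o + slots b R h)
    {p : Op ℕ} (hp : p ∈ iterations b R h o i x) :
    o + i * (b + slots b R h) ≤ p.key ∧ p.key < o + (i + x) * (b + slots b R h) := by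
  obtain ⟨j, hj, hp⟩ := List.mem_flatMap.1 hp
  have hj := List.mem_range'_1.1 hj
  have := key_iteration_of H hp
  have h1 : i * (b + slots b R h) ≤ j * (b + slots b R h) := Nat.mul_le_mul_right _ hj.1
  have h2 : (j + 1) * (b + slots b R h) ≤ (i + x) * (b + slots b R h) :=
    Nat.mul_le_mul_right _ hj.2
  rw [Nat.succ_mul] at h2
  omega

lemma key_loops {b R : ℕ} (h : ℕ) :
    ∀ o, ∀ p ∈ loops b R h o, o ≤ p.key ∧ p.key < o + slots b R h := by
  induction h with
  | zero => intro o p hp; simp [loops] at hp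
  | succ h ih =>
    intro o p hp
    rw [loops_succ] at hp
    have := key_iterations_of ih hp
    simpa [slots] using this

lemma key_iterations {b R h o i x : ℕ} {p : Op ℕ} (hp : p ∈ iterations b R h o i x) :
    o + i * (b + slots b R h) ≤ p.key ∧ p.key < o + (i + x) * (b + slots b R h) :=
  key_iterations_of (key_loops h) hp

lemma moves_insBlock {c o b : ℕ} {S : Finset ℕ} (hS : ∀ x ∈ S, x < o) (hc : S.card + b ≤ c) :
    Moves c S (insBlock o b) (S ∪ Finset.Ico o (o + b)) := by
  induction b generalizing o S with
  | zero => simpa [insBlock] using Moves.nil hc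
  | succ b ih =>
    have ho : o ∉ S := fun h => lt_irrefl _ (hS o h)
    have e : S ∪ Finset.Ico o (o + (b + 1)) = insert o S ∪ Finset.Ico (o + 1) (o + 1 + b) := by
      ext x; simp only [Finset.mem_union, Finset.mem_insert, Finset.mem_Ico]; grind
    rw [insBlock, List.range'_succ, List.map_cons, e]
    refine .ins (by omega) ho (ih ?_ ?_)
    · intro x hx
      rcases Finset.mem_insert.1 hx with rfl | hx
      · omega
      · have := hS x hx; omega
    · rw [Finset.card_insert_of_notMem ho]; omega

lemma moves_delBlock {c o b : ℕ} {S : Finset ℕ} (hS : ∀ x ∈ S, x < o) (hc : S.card + b ≤ c) :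
    Moves c (S ∪ Finset.Ico o (o + b)) (delBlock o b) S := by
  induction b generalizing o with
  | zero => simpa [delBlock] using Moves.nil hc
  | succ b ih =>
    have ho : o ∉ S := fun h => lt_irrefl _ (hS o h)
    have e : (S ∪ Finset.Ico o (o + (b + 1))).erase o
        = S ∪ Finset.Ico (o + 1) (o + 1 + b) := by
      ext x; simp only [Finset.mem_union, Finset.mem_erase, Finset.mem_Ico]; grind
    rw [delBlock, List.range'_succ, List.map_cons]
    refine .del ?_ ?_ ?_
    · refine (Finset.card_union_le _ _).trans ?_
      simpa using hc
    · simp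
    · rw [e]
      exact ih (fun x hx => (hS x hx).trans (Nat.lt_succ_self o)) (by omega)

lemma moves_iterations_of {c b R h o i x : ℕ} {S : Finset ℕ} (hS : ∀ x ∈ S, x < o)
    (hc : S.card ≤ c)
    (H : ∀ o, (∀ x ∈ S, x < o) → Moves c S (iteration b R h o) S) :
    Moves c S (iterations b R h o i x) S := by
  induction x with
  | zero => exact .nil hc
  | succ x ih =>
    rw [← iterations_add, iterations_one]
    exact ih.append (H _ fun x hx => (hS x hx).trans_le (Nat.le_add_right _ _))

lemma moves_iteration {c b R h o : ℕ} {S : Finset ℕ} (hS : ∀ x ∈ S, x < o)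
    (hc : S.card + (h + 1) * b ≤ c) : Moves c S (iteration b R h o) S := by
  induction h generalizing o S with
  | zero =>
    have hc' : S.card + b ≤ c := by simpa using hc
    simpa [iteration, loops] using (moves_insBlock hS hc').append (moves_delBlock hS hc')
  | succ h ih =>
    have hc' : S.card + b + (h + 1) * b ≤ c := by
      rw [Nat.succ_mul] at hc; omega
    refine ((moves_insBlock hS (by omega)).append ?_).append (moves_delBlock hS (by omega))
    rw [loops_succ]
    have hS' : ∀ x ∈ S ∪ Finset.Ico o (o + b), x < o + b := by
      intro x hx
      rcases Finset.mem_union.1 hx with hx | hx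
      · have := hS x hx; omega
      · exact (Finset.mem_Ico.1 hx).2
    have hcard : (S ∪ Finset.Ico o (o + b)).card ≤ S.card + b := by
      simpa using Finset.card_union_le S (Finset.Ico o (o + b))
    exact moves_iterations_of hS' (by omega) fun o ho => ih ho (by omega)

lemma moves_iterations {c b R h o i x : ℕ} {S : Finset ℕ} (hS : ∀ x ∈ S, x < o)
    (hc : S.card + (h + 1) * b ≤ c) : Moves c S (iterations b R h o i x) S :=
  moves_iterations_of hS (by omega) fun _ ho => moves_iteration ho hc

/-! ### Stopping the nested loops at their innermost level -/

/-- A point in the execution of `k` nested loops of `R` iterations over blocks of `b` keys, which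
are preceded by the insertion of `c` keys: `r i` iterations of the loop at level `i` have been
completed and the next one has begun, for each `i < k`. -/
structure Schedule where
  k : ℕ
  b : ℕ
  R : ℕ
  c : ℕ
  r : ℕ → ℕ

namespace Schedule

variable (s : Schedule)

/-- The first slot that is used at level `i`. -/
def off : ℕ → ℕ
  | 0 => s.c
  | i + 1 => off i + s.r i * (s.b + slots s.b s.R (s.k - 1 - i)) + s.b

/-- The first slot of the block that takes the key set from level `i` to level `i + 1`. -/
def blk (i : ℕ) : ℕ := s.off i + s.r i * (s.b + slots s.b s.R (s.k - 1 - i))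

/-- The sequence up to the arrival at level `i`. -/
def pre : ℕ → List (Op ℕ)
  | 0 => insBlock 0 s.c
  | i + 1 => pre i ++ iterations s.b s.R (s.k - 1 - i) (s.off i) 0 (s.r i)
      ++ insBlock (s.blk i) s.b

/-- The sequence up to the departure from level `i`. -/
def mid (i : ℕ) : List (Op ℕ) :=
  s.pre i ++ iterations s.b s.R (s.k - 1 - i) (s.off i) 0 (s.r i)

/-- The sequence up to the first return to level `i` after the departure. -/
def top (i : ℕ) : List (Op ℕ) :=
  s.mid i ++ if i < s.k then iteration s.b s.R (s.k - 1 - i) (s.blk i) else []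

/-- The iterations at level `i` that remain after the first return to that level. -/
def rest (i : ℕ) : List (Op ℕ) :=
  if i < s.k then
    iterations s.b s.R (s.k - 1 - i) (s.off i) (s.r i + 1) (s.R - (s.r i + 1)) else []

/-- The sequence that leads from the first return to level `i + d` to the first return to
level `i`. -/
def down : ℕ → ℕ → List (Op ℕ)
  | 0, _ => []
  | d + 1, i => down d (i + 1) ++ s.rest (i + 1) ++ delBlock (s.blk i) s.b

/-- The key set at level `i`. -/
def keys : ℕ → Finset ℕ
  | 0 => Finset.range s.c
  | i + 1 => keys i ∪ Finset.Ico (s.blk i) (s.blk i + s.b)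

/-- The number of slots used by the nested loops. -/
def total : ℕ := s.c + slots s.b s.R s.k

/-- The largest size of the key set. -/
def capacity : ℕ := s.c + s.k * s.b

/-- The sequence that leads from the departure from level `i` to the departure from the next
level. -/
def climb (i : ℕ) : List (Op ℕ) :=
  insBlock (s.blk i) s.b
    ++ iterations s.b s.R (s.k - 1 - (i + 1)) (s.off (i + 1)) 0 (s.r (i + 1))

/-- The stopping point lies within the execution, and nothing happens at the last level. -/
structure Valid : Prop where
  r_lt : ∀ i < s.k, s.r i < s.R
  r_last : s.r s.k = 0

variable {s}

lemma off_succ (i : ℕ) : s.off (i + 1) = s.blk i + s.b := rfl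

lemma off_le_blk (i : ℕ) : s.off i ≤ s.blk i := Nat.le_add_right _ _

lemma off_mono : Monotone s.off :=
  monotone_nat_of_le_succ fun i => (off_le_blk i).trans (off_succ (s := s) i ▸ Nat.le_add_right _ _)

lemma blk_add_le {i j : ℕ} (h : i < j) : s.blk i + s.b ≤ s.off j :=
  (off_succ (s := s) i).symm.le.trans (off_mono h)

lemma pre_succ (i : ℕ) : s.pre (i + 1) = s.mid i ++ insBlock (s.blk i) s.b := rfl

lemma mid_succ (i : ℕ) : s.mid (i + 1) = s.mid i ++ s.climb i := by
  rw [mid, pre_succ, climb, List.append_assoc]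

lemma mid_ne_nil (hc : 0 < s.c) (i : ℕ) : s.mid i ≠ [] := by
  induction i with
  | zero =>
    intro h
    have := congrArg List.length (List.append_eq_nil_iff.1 h).1
    rw [pre, length_insBlock] at this
    exact hc.ne' this
  | succ i ih =>
    rw [mid_succ]
    exact fun h => ih (List.append_eq_nil_iff.1 h).1

lemma top_of_lt {i : ℕ} (h : i < s.k) :
    s.top i = s.pre i ++ iterations s.b s.R (s.k - 1 - i) (s.off i) 0 (s.r i + 1) := by
  rw [top, if_pos h, mid, List.append_assoc, ← iterations_add, iterations_one, zero_add]
  rfl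

lemma mid_last (hs : s.Valid) : s.mid s.k = s.pre s.k := by
  rw [mid, hs.r_last, iterations_zero, List.append_nil]

lemma top_last : s.top s.k = s.mid s.k := by
  rw [top, if_neg (lt_irrefl _), List.append_nil]

/-- Completing the iterations at level `i` completes the loop at that level. -/
lemma top_append_rest (hs : s.Valid) {i : ℕ} (h : i ≤ s.k) :
    s.top i ++ s.rest i = s.pre i ++ loops s.b s.R (s.k - i) (s.off i) := by
  rcases h.eq_or_lt with rfl | h
  · rw [top_last, mid_last hs, rest, if_neg (lt_irrefl _), Nat.sub_self]; rfl
  · obtain ⟨h', e⟩ : ∃ h', s.k - i = h' + 1 := ⟨s.k - i - 1, by omega⟩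
    have e' : s.k - 1 - i = h' := by omega
    have hr : s.r i + 1 + (s.R - (s.r i + 1)) = s.R := by
      have := hs.r_lt i h; omega
    have := iterations_add s.b s.R h' (s.off i) 0 (s.r i + 1) (s.R - (s.r i + 1))
    rw [hr, zero_add] at this
    rw [top_of_lt h, rest, if_pos h, e, loops_succ, List.append_assoc, e', this]

lemma top_append_down (hs : s.Valid) (d i : ℕ) (h : i + d = s.k) :
    s.top s.k ++ s.down d i = s.top i := by
  induction d generalizing i with
  | zero =>
    obtain rfl : i = s.k := by omega
    exact List.append_nil _
  | succ d ih =>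
    have e : s.k - (i + 1) = s.k - 1 - i := by omega
    rw [down, ← List.append_assoc, ← List.append_assoc, ih (i + 1) (by omega),
      top_append_rest hs (by omega), pre_succ, e, top, if_pos (by omega), iteration, off_succ]
    simp only [List.append_assoc]

lemma keys_lt {i x : ℕ} (hx : x ∈ s.keys i) : x < s.off i := by
  induction i with
  | zero => exact Finset.mem_range.1 hx
  | succ i ih =>
    rcases Finset.mem_union.1 hx with hx | hx
    · exact (ih hx).trans_le (off_mono (Nat.le_succ i))
    · exact (Finset.mem_Ico.1 hx).2

lemma keys_mono : Monotone s.keys :=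
  monotone_nat_of_le_succ fun _ => Finset.subset_union_left

lemma card_keys_le (i : ℕ) : (s.keys i).card ≤ s.c + i * s.b := by
  induction i with
  | zero => simp [keys]
  | succ i ih =>
    refine (Finset.card_union_le _ _).trans ?_
    rw [Nat.card_Ico, Nat.succ_mul]; omega

lemma card_keys_add_le {i : ℕ} (h : i < s.k) :
    (s.keys i).card + (s.k - 1 - i + 1) * s.b ≤ s.capacity := by
  have := card_keys_le (s := s) i
  have e : s.k * s.b = i * s.b + (s.k - 1 - i + 1) * s.b := by
    rw [← Nat.add_mul]; congr 1; omega
  rw [capacity, e]; omega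

lemma card_keys_le_capacity {i : ℕ} (h : i ≤ s.k) : (s.keys i).card ≤ s.capacity := by
  refine (card_keys_le i).trans ?_
  rw [capacity]
  have := Nat.mul_le_mul_right s.b h
  omega

lemma moves_insBlock_blk {i : ℕ} (h : i < s.k) :
    Moves s.capacity (s.keys i) (insBlock (s.blk i) s.b) (s.keys (i + 1)) := by
  refine moves_insBlock (fun x hx => (keys_lt hx).trans_le (off_le_blk i)) ?_
  have := card_keys_add_le (s := s) (i := i) h
  rw [Nat.succ_mul] at this
  omega

lemma moves_mid_of (hs : s.Valid) {i : ℕ} (h : i ≤ s.k)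
    (H : Moves s.capacity ∅ (s.pre i) (s.keys i)) :
    Moves s.capacity ∅ (s.mid i) (s.keys i) := by
  rcases h.eq_or_lt with rfl | h
  · rwa [mid_last hs]
  · exact H.append (moves_iterations (fun _ => keys_lt) (card_keys_add_le h))

lemma moves_pre (hs : s.Valid) (i : ℕ) (h : i ≤ s.k) :
    Moves s.capacity ∅ (s.pre i) (s.keys i) := by
  induction i with
  | zero =>
    have := moves_insBlock (c := s.capacity) (o := 0) (b := s.c) (S := ∅) (by simp)
      (by simp [capacity])
    rwa [Finset.empty_union, zero_add, ← Finset.range_eq_Ico] at this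
  | succ i ih =>
    exact (moves_mid_of hs (by omega) (ih (by omega))).append (moves_insBlock_blk h)

lemma moves_mid (hs : s.Valid) {i : ℕ} (h : i ≤ s.k) :
    Moves s.capacity ∅ (s.mid i) (s.keys i) :=
  moves_mid_of hs h (moves_pre hs i h)

lemma moves_top (hs : s.Valid) {i : ℕ} (h : i ≤ s.k) :
    Moves s.capacity ∅ (s.top i) (s.keys i) := by
  refine (moves_mid hs h).append ?_
  split_ifs with h'
  · exact moves_iteration (fun x hx => (keys_lt hx).trans_le (off_le_blk i)) (card_keys_add_le h')
  · exact .nil (card_keys_le_capacity h)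

lemma moves_pre_append_iterations (hs : s.Valid) {i : ℕ} (h : i < s.k) (x : ℕ) :
    Moves s.capacity ∅
      (s.pre i ++ iterations s.b s.R (s.k - 1 - i) (s.off i) 0 x) (s.keys i) :=
  (moves_pre hs i h.le).append (moves_iterations (fun _ => keys_lt) (card_keys_add_le h))

lemma exists_moves_climb (hs : s.Valid) {i : ℕ} (h : i < s.k) :
    ∃ T, Moves (s.b + s.k * s.b) ∅ (s.climb i) T := by
  have h1 : Moves (s.b + s.k * s.b) ∅ (insBlock (s.blk i) s.b)
      (Finset.Ico (s.blk i) (s.blk i + s.b)) := by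
    simpa using moves_insBlock (c := s.b + s.k * s.b) (o := s.blk i) (b := s.b) (S := ∅)
      (by simp) (by simp)
  have hlt : ∀ x ∈ Finset.Ico (s.blk i) (s.blk i + s.b), x < s.off (i + 1) :=
    fun x hx => (Finset.mem_Ico.1 hx).2
  rcases Nat.eq_or_lt_of_le (Nat.succ_le_of_lt h) with h | h
  · have : s.r (i + 1) = 0 := by
      have := hs.r_last
      rwa [← h] at this
    rw [climb, this, iterations_zero, List.append_nil]
    exact ⟨_, h1⟩
  · refine ⟨_, h1.append (moves_iterations hlt ?_)⟩
    rw [Nat.card_Ico, Nat.add_sub_cancel_left]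
    have : s.k - 1 - (i + 1) + 1 ≤ s.k := by omega
    have := Nat.mul_le_mul_right s.b this
    omega

/-- The slots from `off i` on suffice for the nested loops at the levels from `i` on. -/
lemma off_add_slots_le (hs : s.Valid) {i : ℕ} (h : i ≤ s.k) :
    s.off i + slots s.b s.R (s.k - i) ≤ s.total := by
  induction i with
  | zero => exact le_rfl
  | succ i ih =>
    refine le_trans ?_ (ih (by omega))
    have e : s.k - i = s.k - 1 - i + 1 := by omega
    have e' : s.k - (i + 1) = s.k - 1 - i := by omega
    have := Nat.mul_le_mul_right (s.b + slots s.b s.R (s.k - 1 - i)) (hs.r_lt i (by omega))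
    rw [Nat.succ_mul] at this
    rw [e, e', slots, off]
    omega

lemma off_add_iterations_le (hs : s.Valid) {i x : ℕ} (h : i < s.k) (hx : x ≤ s.R) :
    s.off i + x * (s.b + slots s.b s.R (s.k - 1 - i)) ≤ s.total := by
  refine le_trans ?_ (off_add_slots_le hs h.le)
  have e : s.k - i = s.k - 1 - i + 1 := by omega
  rw [e, slots]
  exact Nat.add_le_add_left (Nat.mul_le_mul_right _ hx) _

lemma length_pre_le (i : ℕ) : (s.pre i).length ≤ 2 * s.off i := by
  induction i with
  | zero => simp [pre, off, length_insBlock]; omega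
  | succ i ih =>
    simp only [pre, List.length_append, length_iterations, length_insBlock, off]
    omega

lemma key_pre (i : ℕ) : ∀ p ∈ s.pre i, p.key < s.off i := by
  induction i with
  | zero =>
    intro p hp
    simpa [off] using (key_insBlock hp).2
  | succ i ih =>
    intro p hp
    rcases List.mem_append.1 hp with hp | hp
    · rcases List.mem_append.1 hp with hp | hp
      · exact (ih p hp).trans_le (off_mono (Nat.le_succ i))
      · have := (key_iterations hp).2
        rw [zero_add] at this
        exact this.trans_le (Nat.le_add_right _ _)
    · exact (key_insBlock hp).2

lemma key_mid {i : ℕ} {p : Op ℕ} (hp : p ∈ s.mid i) : p.key < s.blk i := by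
  rcases List.mem_append.1 hp with hp | hp
  · exact (key_pre i p hp).trans_le (off_le_blk i)
  · simpa [blk] using (key_iterations hp).2

lemma key_pre_append_iterations (hs : s.Valid) {i x : ℕ} (h : i < s.k) (hx : x ≤ s.R) :
    ∀ p ∈ s.pre i ++ iterations s.b s.R (s.k - 1 - i) (s.off i) 0 x, p.key < s.total := by
  intro p hp
  have := off_add_iterations_le hs h hx
  rcases List.mem_append.1 hp with hp | hp
  · have := key_pre i p hp; omega
  · have := (key_iterations hp).2
    rw [zero_add] at this; omega

lemma length_pre_append_iterations_le (hs : s.Valid) {i x : ℕ} (h : i < s.k) (hx : x ≤ s.R) :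
    (s.pre i ++ iterations s.b s.R (s.k - 1 - i) (s.off i) 0 x).length ≤ 2 * s.total := by
  have := off_add_iterations_le hs h hx
  have := length_pre_le (s := s) i
  rw [List.length_append, length_iterations]
  omega

lemma off_le_total (hs : s.Valid) {i : ℕ} (h : i ≤ s.k) : s.off i ≤ s.total :=
  (Nat.le_add_right _ _).trans (off_add_slots_le hs h)

lemma key_top (hs : s.Valid) {i : ℕ} (h : i ≤ s.k) : ∀ p ∈ s.top i, p.key < s.total := by
  rcases h.eq_or_lt with rfl | h
  · rw [top_last, mid_last hs]
    exact fun p hp => (key_pre s.k p hp).trans_le (off_le_total hs le_rfl)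
  · rw [top_of_lt h]
    exact key_pre_append_iterations hs h (hs.r_lt i h)

lemma length_top_le (hs : s.Valid) {i : ℕ} (h : i ≤ s.k) :
    (s.top i).length ≤ 2 * s.total := by
  rcases h.eq_or_lt with rfl | h
  · rw [top_last, mid_last hs]
    exact (length_pre_le s.k).trans (Nat.mul_le_mul_left _ (off_le_total hs le_rfl))
  · rw [top_of_lt h]
    exact length_pre_append_iterations_le hs h (hs.r_lt i h)

lemma length_mid_le (hs : s.Valid) {i : ℕ} (h : i ≤ s.k) :
    (s.mid i).length ≤ 2 * s.total := by
  refine le_trans ?_ (length_top_le hs h)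
  rw [top, List.length_append]
  exact Nat.le_add_right _ _

lemma key_mid_lt_total (hs : s.Valid) {i : ℕ} (h : i ≤ s.k) :
    ∀ p ∈ s.mid i, p.key < s.total :=
  fun p hp => key_top hs h p (List.mem_append_left _ hp)

lemma key_rest {i : ℕ} {p : Op ℕ} (hp : p ∈ s.rest i) : s.off i ≤ p.key := by
  rw [rest] at hp
  split_ifs at hp with h
  · exact (Nat.le_add_right _ _).trans (key_iterations hp).1
  · simp at hp

lemma key_down {d i : ℕ} : ∀ p ∈ s.down d i, s.blk i ≤ p.key := by
  induction d generalizing i with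
  | zero => intro p hp; simp [down] at hp
  | succ d ih =>
    intro p hp
    have h0 : s.blk i + s.b ≤ s.off (i + 1) := le_rfl
    have h1 := off_le_blk (s := s) (i + 1)
    rcases List.mem_append.1 hp with hp | hp
    · rcases List.mem_append.1 hp with hp | hp
      · have := ih p hp; omega
      · have := key_rest hp; omega
    · exact (key_delBlock hp).1

/-- The stopping point can be chosen level by level: the choice at level `i` may depend on what
precedes the arrival at that level. -/
lemma exists_schedule (k b R c : ℕ) (P : ℕ → List (Op ℕ) → ℕ → ℕ → Prop)
    (hP : ∀ i w o, ∃ x, P i w o x) :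
    ∃ s : Schedule, s.k = k ∧ s.b = b ∧ s.R = R ∧ s.c = c ∧
      ∀ i, P i (s.pre i) (s.off i) (s.r i) := by
  choose f hf using hP
  let st : ℕ → List (Op ℕ) × ℕ := fun i => Nat.rec (insBlock 0 c, c) (fun i p =>
    (p.1 ++ iterations b R (k - 1 - i) p.2 0 (f i p.1 p.2)
      ++ insBlock (p.2 + f i p.1 p.2 * (b + slots b R (k - 1 - i))) b,
      p.2 + f i p.1 p.2 * (b + slots b R (k - 1 - i)) + b)) i
  let s : Schedule := ⟨k, b, R, c, fun i => f i (st i).1 (st i).2⟩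
  have key : ∀ i, s.pre i = (st i).1 ∧ s.off i = (st i).2 := by
    intro i
    induction i with
    | zero => exact ⟨rfl, rfl⟩
    | succ i ih =>
      constructor
      · rw [pre, blk, ih.1, ih.2]
      · rw [off, ih.2]
  refine ⟨s, rfl, rfl, rfl, rfl, fun i => ?_⟩
  rw [(key i).1, (key i).2]
  exact hf _ _ _

end Schedule

/-! ### Guessing keys one after the other -/

section Guessing

variable {ι U : Type*} [Fintype ι] [DecidableEq ι] [Fintype U]

lemma sum_sum_update (j : ι) (f : (ι → U) → ℝ) :
    ∑ φ, ∑ x, f (Function.update φ j x) = Fintype.card U * ∑ φ, f φ := by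
  classical
  let e : (ι → U) × U → (ι → U) × U := fun z => (Function.update z.1 j z.2, z.1 j)
  have he : Function.Involutive e := by
    rintro ⟨φ, x⟩
    simp [e]
  have h := Equiv.sum_comp he.toPerm (fun z : (ι → U) × U => f z.1)
  rw [Fintype.sum_prod_type, Fintype.sum_prod_type] at h
  simpa [e, Finset.mul_sum] using h

/-- If `q φ` is a subprobability for each `φ`, then guessing the values at the indices in `A`
independently with `q φ` costs a factor `card U` for each index, on average over all `φ`. -/
lemma card_pow_mul_sum_mul_prod_le (A : Finset ι) (g : (ι → U) → ℝ) (hg0 : ∀ φ, 0 ≤ g φ)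
    (hg : DependsOn g (↑A)ᶜ) (q : (ι → U) → U → ℝ) (hq0 : ∀ φ x, 0 ≤ q φ x)
    (hq : DependsOn q (↑A)ᶜ) (hq1 : ∀ φ, ∑ x, q φ x ≤ 1) :
    (Fintype.card U : ℝ) ^ A.card * ∑ φ, g φ * ∏ j ∈ A, q φ (φ j) ≤ ∑ φ, g φ := by
  induction A using Finset.induction_on generalizing g with
  | empty => simp
  | insert j A hj ih =>
    have hsub : ((↑(insert j A) : Set ι))ᶜ ⊆ (↑A : Set ι)ᶜ :=
      Set.compl_subset_compl.2 (by simp)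
    have hg' : DependsOn (fun φ => g φ * q φ (φ j)) ((↑A : Set ι)ᶜ) := by
      intro φ ψ h
      have e1 := hg (fun i hi => h i (hsub hi))
      have e2 := hq (fun i hi => h i (hsub hi))
      have e3 := h j (by simpa using hj)
      simp only [e1, e2, e3]
    have h1 := ih (fun φ => g φ * q φ (φ j)) (fun φ => mul_nonneg (hg0 φ) (hq0 _ _)) hg'
      (fun φ ψ h => hq (fun i hi => h i (hsub hi)))
    have h2 : (Fintype.card U : ℝ) * ∑ φ, g φ * q φ (φ j) ≤ ∑ φ, g φ := by
      rw [← sum_sum_update j]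
      refine Finset.sum_le_sum fun φ _ => ?_
      have hupd : ∀ x, ∀ i ∈ ((↑(insert j A) : Set ι))ᶜ, Function.update φ j x i = φ i := by
        intro x i hi
        refine Function.update_of_ne ?_ _ _
        rintro rfl
        simp at hi
      have : ∀ x, g (Function.update φ j x) * q (Function.update φ j x) (Function.update φ j x j)
          = g φ * q φ x := by
        intro x
        rw [hg (hupd x), hq (hupd x), Function.update_self]
      simp only [this, ← Finset.mul_sum]
      exact mul_le_of_le_one_right (hg0 φ) (hq1 φ)
    rw [Finset.card_insert_of_notMem hj, pow_succ]
    calc _ = (Fintype.card U : ℝ) * ((Fintype.card U : ℝ) ^ A.card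
          * ∑ φ, (g φ * q φ (φ j)) * ∏ i ∈ A, q φ (φ i)) := by
          simp only [Finset.prod_insert hj]
          ring_nf
      _ ≤ (Fintype.card U : ℝ) * ∑ φ, g φ * q φ (φ j) := by gcongr
      _ ≤ _ := h2

end Guessing

/-! ### The guess for a single key -/

section Guess

variable {U : Type*} [DecidableEq U]

/-- An unnormalized distribution for a key that is known to lie in `B` and unlikely to lie in
`E`. -/
noncomputable def guessWeight (w e : ℝ) (B E : Finset U) (x : U) : ℝ :=
  (if x ∈ B \ E then w⁻¹ else 0) + if x ∈ B then e else 0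

/-- The total mass of `guessWeight w e B E`. -/
noncomputable def guessMass (w e : ℝ) (B E : Finset U) : ℝ :=
  (B \ E).card / w + e * B.card

/-- The distribution proportional to `guessWeight w e B E`; it vanishes if `B` is empty. -/
noncomputable def guess (w e : ℝ) (B E : Finset U) (x : U) : ℝ :=
  guessWeight w e B E x / guessMass w e B E

variable {w e : ℝ} (hw : 0 < w) (he : 0 < e) (B E : Finset U)
include hw he

lemma guessWeight_nonneg (x : U) : 0 ≤ guessWeight w e B E x := by
  unfold guessWeight
  split_ifs <;> positivity

lemma guessMass_nonneg : 0 ≤ guessMass w e B E := by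
  unfold guessMass
  positivity

lemma guess_nonneg (x : U) : 0 ≤ guess w e B E x :=
  div_nonneg (guessWeight_nonneg hw he B E x) (guessMass_nonneg hw he B E)

omit hw he in
lemma sum_guess_le_one [Fintype U] : ∑ x, guess w e B E x ≤ 1 := by
  have h : ∑ x, guessWeight w e B E x = guessMass w e B E := by
    unfold guessWeight guessMass
    rw [Finset.sum_add_distrib, ← Finset.sum_filter, ← Finset.sum_filter,
      Finset.sum_const, Finset.sum_const, nsmul_eq_mul, nsmul_eq_mul,
      Finset.filter_mem_eq_inter, Finset.filter_mem_eq_inter,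
      Finset.univ_inter, Finset.univ_inter]
    ring
  unfold guess
  rw [← Finset.sum_div, h]
  exact div_self_le_one _

lemma guess_pos {x : U} (hx : x ∈ B) : 0 < guess w e B E x := by
  have : 0 < (B.card : ℝ) := by exact_mod_cast Finset.card_pos.2 ⟨x, hx⟩
  unfold guess guessWeight guessMass
  rw [if_pos hx]
  have h : 0 ≤ (if x ∈ B \ E then w⁻¹ else 0) := by split_ifs <;> positivity
  positivity

lemma neg_log_guess_le {x : U} (hx : x ∈ B) :
    -Real.log (guess w e B E x) ≤ Real.log w + Real.log (1 / (w * e)) * (if x ∈ E then 1 else 0)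
      + ((B \ E).card / w + e * B.card - 1) := by
  have hB : 0 < (B.card : ℝ) := by exact_mod_cast Finset.card_pos.2 ⟨x, hx⟩
  have hZ : 0 < guessMass w e B E := by unfold guessMass; positivity
  have hv : 0 < guessWeight w e B E x := by
    unfold guessWeight
    rw [if_pos hx]
    have h : 0 ≤ (if x ∈ B \ E then w⁻¹ else 0) := by split_ifs <;> positivity
    positivity
  have h1 : Real.log (guessMass w e B E) ≤ (B \ E).card / w + e * B.card - 1 :=
    Real.log_le_sub_one_of_pos hZ
  have h2 : -Real.log (guessWeight w e B E x)
      ≤ Real.log w + Real.log (1 / (w * e)) * (if x ∈ E then 1 else 0) := by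
    unfold guessWeight at hv ⊢
    rw [if_pos hx] at hv ⊢
    by_cases hE : x ∈ E
    · rw [if_neg (by simp [hE]), if_pos hE, zero_add, one_div, Real.log_inv,
        Real.log_mul hw.ne' he.ne']
      linarith
    · rw [if_pos (by simp [hE, hx]), if_neg hE, mul_zero, add_zero]
      have := Real.log_le_log (inv_pos.2 hw) (le_add_of_nonneg_right he.le : w⁻¹ ≤ w⁻¹ + e)
      rw [Real.log_inv] at this
      linarith
  unfold guess
  rw [Real.log_div hv.ne' hZ.ne']
  linarith

end Guess

/-! ### Averages over tapes and keys -/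

section Average

variable {ι Φ : Type*} [Fintype ι]

/-- The average of `f` over a random index with law `p` and an independent uniformly random
element of `I`. -/
noncomputable def avg (p : ι → ℝ) (I : Finset Φ) (f : ι → Φ → ℝ) : ℝ :=
  ∑ i, ∑ φ ∈ I, p i / I.card * f i φ

variable {p : ι → ℝ} {I : Finset Φ} {f g : ι → Φ → ℝ}

lemma avg_mono (hp : ∀ i, 0 ≤ p i) (h : ∀ i, ∀ φ ∈ I, f i φ ≤ g i φ) :
    avg p I f ≤ avg p I g :=
  Finset.sum_le_sum fun i _ => Finset.sum_le_sum fun φ hφ =>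
    mul_le_mul_of_nonneg_left (h i φ hφ) (div_nonneg (hp i) (Nat.cast_nonneg _))

lemma avg_nonneg (hp : ∀ i, 0 ≤ p i) (h : ∀ i, ∀ φ ∈ I, 0 ≤ f i φ) : 0 ≤ avg p I f :=
  Finset.sum_nonneg fun i _ => Finset.sum_nonneg fun φ hφ =>
    mul_nonneg (div_nonneg (hp i) (Nat.cast_nonneg _)) (h i φ hφ)

lemma avg_congr (h : ∀ i, ∀ φ ∈ I, f i φ = g i φ) : avg p I f = avg p I g :=
  Finset.sum_congr rfl fun i _ => Finset.sum_congr rfl fun φ hφ => by rw [h i φ hφ]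

lemma avg_add : avg p I (fun i φ => f i φ + g i φ) = avg p I f + avg p I g := by
  simp only [avg, mul_add, Finset.sum_add_distrib]

lemma avg_sub : avg p I (fun i φ => f i φ - g i φ) = avg p I f - avg p I g := by
  simp only [avg, mul_sub, Finset.sum_sub_distrib]

lemma avg_const_mul (c : ℝ) : avg p I (fun i φ => c * f i φ) = c * avg p I f := by
  simp only [avg, Finset.mul_sum]
  refine Finset.sum_congr rfl fun i _ => Finset.sum_congr rfl fun φ _ => by ring

lemma avg_sum {κ : Type*} (A : Finset κ) (F : κ → ι → Φ → ℝ) :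
    avg p I (fun i φ => ∑ a ∈ A, F a i φ) = ∑ a ∈ A, avg p I (F a) := by
  classical
  induction A using Finset.induction_on with
  | empty => simp [avg]
  | insert a A ha ih => simp only [Finset.sum_insert ha, avg_add, ih]

lemma avg_const (hp1 : ∑ i, p i = 1) (hI : I.Nonempty) (c : ℝ) :
    avg p I (fun _ _ => c) = c := by
  have : (I.card : ℝ) ≠ 0 := by exact_mod_cast hI.card_pos.ne'
  simp only [avg, Finset.sum_const, nsmul_eq_mul]
  calc _ = ∑ i, p i * c := Finset.sum_congr rfl fun i _ => by field_simp
    _ = c := by rw [← Finset.sum_mul, hp1, one_mul]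

/-- A bound that holds on average over the index for each element of `I` holds on average. -/
lemma avg_le_of_forall (hI : I.Nonempty) {c : ℝ} (h : ∀ φ ∈ I, ∑ i, p i * f i φ ≤ c) :
    avg p I f ≤ c := by
  have hc : (0 : ℝ) < I.card := by exact_mod_cast hI.card_pos
  have e : avg p I f = (∑ φ ∈ I, ∑ i, p i * f i φ) / I.card := by
    rw [avg, Finset.sum_comm, Finset.sum_div]
    refine Finset.sum_congr rfl fun φ _ => ?_
    rw [Finset.sum_div]
    exact Finset.sum_congr rfl fun i _ => by ring
  rw [e, div_le_iff₀ hc]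
  calc _ ≤ ∑ φ ∈ I, c := Finset.sum_le_sum h
    _ = _ := by rw [Finset.sum_const, nsmul_eq_mul, mul_comm]

end Average

/-! ### Decoding the keys from the memory -/

/-- What the decoding of the present keys from the memory relies on. The keys are assigned to `L`
slots by `φ`; for `j < k`, the `b` slots from `blk j` on form the block number `j`, and the first
`c` slots are the base. The memory `mem i φ` depends on the index `i` of a tape.
The set `early a i φ` is unlikely to contain the keys from block `a` on, and `late a i s φ` is a set
which contains the keys before block `a` if `s` is the memory; each of the two sets can be
computed without knowing the keys that it is about. The differences of `G` bound the mean sizes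
of the differences of these sets; they are at least `W / ρ`, where `W` bounds the mean sizes of the
late sets. -/
structure Scheme (ι U Mem : Type*) [Fintype ι] [DecidableEq U] (L k b c : ℕ) where
  p : ι → ℝ
  assignments : Finset (Fin L → U)
  mem : ι → (Fin L → U) → Mem
  blk : ℕ → ℕ
  early : ℕ → ι → (Fin L → U) → Finset U
  late : ℕ → ι → Mem → (Fin L → U) → Finset U
  G : ℕ → ℝ
  ε : ℝ
  W : ℝ
  ρ : ℝ
  p_nonneg : ∀ i, 0 ≤ p i
  sum_p : ∑ i, p i = 1
  assignments_nonempty : assignments.Nonempty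
  le_blk_zero : c ≤ blk 0
  blk_add_le : ∀ j, blk j + b ≤ blk (j + 1)
  blk_last_le : blk k ≤ L
  early_dependsOn : ∀ a i, DependsOn (early a i) {s : Fin L | (s : ℕ) < blk a}
  late_dependsOn : ∀ a i s, DependsOn (late a i s) {s : Fin L | blk a ≤ (s : ℕ)}
  ε_pos : 0 < ε
  W_pos : 0 < W
  G_strictMono : StrictMono G
  one_le_div : 1 ≤ ρ / ε
  W_le : ∀ a a', a < a' → W ≤ ρ * (G a' - G a)
  one_le_ρ : 1 ≤ ρ
  base_mem_late : ∀ i, ∀ φ ∈ assignments, ∀ s : Fin L, (s : ℕ) < c →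
    φ s ∈ late k i (mem i φ) φ
  mem_late : ∀ i, ∀ φ ∈ assignments, ∀ j a, j < a → a ≤ k → ∀ s : Fin L,
    blk j ≤ s → (s : ℕ) < blk j + b → φ s ∈ late a i (mem i φ) φ
  avg_mem_early_le : ∀ a < k, ∀ s : Fin L, blk a ≤ s →
    avg p assignments (fun i φ => if φ s ∈ early a i φ then 1 else 0) ≤ ε
  avg_card_sdiff_le : ∀ a a', a < a' → a' ≤ k →
    avg p assignments (fun i φ => ((late a' i (mem i φ) φ \ early a i φ).card : ℝ)) ≤ G a' - G a
  avg_card_late_le : ∀ a ≤ k,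
    avg p assignments (fun i φ => ((late a i (mem i φ) φ).card : ℝ)) ≤ W

namespace Scheme

variable {ι U Mem : Type*} [Fintype ι] [DecidableEq U] {L k b c : ℕ}
variable (𝒮 : Scheme ι U Mem L k b c)

/-- The slots of block `j`. -/
def block (j : ℕ) : Finset (Fin L) :=
  Finset.univ.filter fun s => 𝒮.blk j ≤ s ∧ (s : ℕ) < 𝒮.blk j + b

/-- The slots of the base. -/
def base (_ : Scheme ι U Mem L k b c) : Finset (Fin L) := Finset.univ.filter fun s => (s : ℕ) < c

/-- The slots of the blocks number `a, …, a + l - 1`. -/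
def hidden (a l : ℕ) : Finset (Fin L) := (Finset.Ico a (a + l)).biUnion 𝒮.block

/-- The error term in the cost of a key. -/
noncomputable def err : ℝ := 𝒮.ε * Real.log (𝒮.ρ / 𝒮.ε) + 𝒮.ε

/-- `Q` predicts the keys in the slots `A` from the memory and the keys in the other slots, with
mean logarithmic loss at most `κ`. -/
structure Predicts [Fintype U] (A : Finset (Fin L)) (κ : ℝ) (Q : ι → Mem → (Fin L → U) → ℝ) :
    Prop where
  nonneg : ∀ i s φ, 0 ≤ Q i s φ
  sum_le : ∀ i s (g : (Fin L → U) → ℝ), (∀ φ, 0 ≤ g φ) → DependsOn g (↑A)ᶜ →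
    (Fintype.card U : ℝ) ^ A.card * ∑ φ, g φ * Q i s φ ≤ ∑ φ, g φ
  pos : ∀ i, ∀ φ ∈ 𝒮.assignments, 0 < Q i (𝒮.mem i φ) φ
  avg_le : avg 𝒮.p 𝒮.assignments (fun i φ => -Real.log (Q i (𝒮.mem i φ) φ)) ≤ κ

variable {𝒮}

lemma blk_mono : Monotone 𝒮.blk :=
  monotone_nat_of_le_succ fun j => (Nat.le_add_right _ _).trans (𝒮.blk_add_le j)

lemma blk_add_le_of_lt {i j : ℕ} (h : i < j) : 𝒮.blk i + b ≤ 𝒮.blk j :=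
  (𝒮.blk_add_le i).trans (blk_mono h)

lemma mem_block {j : ℕ} {s : Fin L} : s ∈ 𝒮.block j ↔ 𝒮.blk j ≤ s ∧ (s : ℕ) < 𝒮.blk j + b := by
  simp [block]

lemma mem_hidden {a l : ℕ} {s : Fin L} :
    s ∈ 𝒮.hidden a l ↔ ∃ j, (a ≤ j ∧ j < a + l) ∧ 𝒮.blk j ≤ s ∧ (s : ℕ) < 𝒮.blk j + b := by
  simp [hidden, mem_block]

lemma blk_le_of_mem_hidden {a l : ℕ} {s : Fin L} (h : s ∈ 𝒮.hidden a l) : 𝒮.blk a ≤ s := by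
  obtain ⟨j, hj, h1, h2⟩ := mem_hidden.1 h
  exact (blk_mono hj.1).trans h1

lemma lt_blk_of_mem_hidden {a l : ℕ} {s : Fin L} (h : s ∈ 𝒮.hidden a l) :
    (s : ℕ) < 𝒮.blk (a + l) := by
  obtain ⟨j, hj, h1, h2⟩ := mem_hidden.1 h
  exact h2.trans_le (blk_add_le_of_lt hj.2)

lemma card_filter_Ico {o e : ℕ} (h : e ≤ L) :
    (Finset.univ.filter fun s : Fin L => o ≤ (s : ℕ) ∧ (s : ℕ) < e).card = e - o := by
  have : ((Finset.univ.filter fun s : Fin L => o ≤ (s : ℕ) ∧ (s : ℕ) < e).map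
      Fin.valEmbedding) = Finset.Ico o e := by
    ext x
    simp only [Finset.mem_map, Finset.mem_filter, Finset.mem_univ, true_and,
      Fin.valEmbedding_apply, Finset.mem_Ico]
    constructor
    · rintro ⟨s, hs, rfl⟩; exact hs
    · intro hx; exact ⟨⟨x, by omega⟩, hx, rfl⟩
  rw [← Finset.card_map, this, Nat.card_Ico]

lemma card_block {j : ℕ} (h : j < k) : (𝒮.block j).card = b := by
  have h1 : 𝒮.blk j + b ≤ L := (blk_add_le_of_lt h).trans 𝒮.blk_last_le
  rw [block, card_filter_Ico h1, Nat.add_sub_cancel_left]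

lemma card_base : 𝒮.base.card = c := by
  have h1 : c ≤ L := 𝒮.le_blk_zero.trans ((blk_mono (Nat.zero_le k)).trans 𝒮.blk_last_le)
  have := card_filter_Ico (o := 0) h1
  simpa [base] using this

lemma hidden_zero (a : ℕ) : 𝒮.hidden a 0 = ∅ := by simp [hidden]

lemma hidden_succ_left (a l : ℕ) : 𝒮.hidden a (l + 1) = 𝒮.block a ∪ 𝒮.hidden (a + 1) l := by
  ext s
  simp only [Finset.mem_union, mem_hidden, mem_block]
  constructor
  · rintro ⟨j, hj, h⟩
    rcases hj.1.eq_or_lt with rfl | hlt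
    · exact .inl h
    · exact .inr ⟨j, by omega, h⟩
  · rintro (h | ⟨j, hj, h⟩)
    · exact ⟨a, by omega, h⟩
    · exact ⟨j, by omega, h⟩

lemma hidden_succ_right (a l : ℕ) : 𝒮.hidden a (l + 1) = 𝒮.block (a + l) ∪ 𝒮.hidden a l := by
  ext s
  simp only [Finset.mem_union, mem_hidden, mem_block]
  constructor
  · rintro ⟨j, hj, h⟩
    rcases (show j ≤ a + l by omega).eq_or_lt with rfl | hlt
    · exact .inl h
    · exact .inr ⟨j, by omega, h⟩
  · rintro (h | ⟨j, hj, h⟩)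
    · exact ⟨a + l, by omega, h⟩
    · exact ⟨j, by omega, h⟩

lemma disjoint_block_hidden {j a l : ℕ} (h : j < a ∨ a + l ≤ j) :
    Disjoint (𝒮.block j) (𝒮.hidden a l) := by
  rw [Finset.disjoint_left]
  intro s h1 h2
  have h1 := mem_block.1 h1
  have h3 := blk_le_of_mem_hidden h2
  have h4 := lt_blk_of_mem_hidden h2
  rcases h with h | h
  · have := blk_add_le_of_lt (𝒮 := 𝒮) h; omega
  · have := blk_mono (𝒮 := 𝒮) h; omega

lemma card_hidden (l a : ℕ) (h : a + l ≤ k) : (𝒮.hidden a l).card = l * b := by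
  induction l generalizing a with
  | zero => simp [hidden_zero]
  | succ l ih =>
    rw [hidden_succ_left, Finset.card_union_of_disjoint
      (disjoint_block_hidden (.inl (Nat.lt_succ_self a))), card_block (by omega),
      ih (a + 1) (by omega)]
    ring

lemma log_div_nonneg : 0 ≤ Real.log (𝒮.ρ / 𝒮.ε) := Real.log_nonneg 𝒮.one_le_div

/-- The mean logarithmic loss of a single key. -/
lemma avg_neg_log_guess_le {w : ℝ} (hw : 0 < w) (hwW : 𝒮.W ≤ 𝒮.ρ * w) (s : Fin L)
    (B E : ι → (Fin L → U) → Finset U)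
    (hB : ∀ i, ∀ φ ∈ 𝒮.assignments, φ s ∈ B i φ)
    (hE : avg 𝒮.p 𝒮.assignments (fun i φ => if φ s ∈ E i φ then 1 else 0) ≤ 𝒮.ε)
    (hBE : avg 𝒮.p 𝒮.assignments (fun i φ => ((B i φ \ E i φ).card : ℝ)) ≤ w)
    (hBW : avg 𝒮.p 𝒮.assignments (fun i φ => ((B i φ).card : ℝ)) ≤ 𝒮.W) :
    avg 𝒮.p 𝒮.assignments
        (fun i φ => -Real.log (guess w (𝒮.ε / 𝒮.W) (B i φ) (E i φ) (φ s)))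
      ≤ Real.log w + 𝒮.err := by
  have hε := 𝒮.ε_pos
  have hW := 𝒮.W_pos
  have he : 0 < 𝒮.ε / 𝒮.W := div_pos hε hW
  -- A key in `E` costs at most `log (ρ / ε)` more than the others, but this happens with
  -- probability at most `ε` only.
  have hlog : Real.log (1 / (w * (𝒮.ε / 𝒮.W))) ≤ Real.log (𝒮.ρ / 𝒮.ε) := by
    refine Real.log_le_log (by positivity) ?_
    rw [div_le_div_iff₀ (by positivity) hε, one_mul]
    calc 𝒮.ε = 𝒮.W * (𝒮.ε / 𝒮.W) := by field_simp
      _ ≤ (𝒮.ρ * w) * (𝒮.ε / 𝒮.W) := by gcongr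
      _ = _ := by ring
  have hE0 : 0 ≤ avg 𝒮.p 𝒮.assignments (fun i φ => if φ s ∈ E i φ then (1 : ℝ) else 0) :=
    avg_nonneg 𝒮.p_nonneg fun i φ _ => by split_ifs <;> norm_num
  calc _ ≤ avg 𝒮.p 𝒮.assignments (fun i φ => (Real.log w
        + Real.log (1 / (w * (𝒮.ε / 𝒮.W))) * (if φ s ∈ E i φ then 1 else 0))
        + ((w⁻¹ * ((B i φ \ E i φ).card : ℝ) + 𝒮.ε / 𝒮.W * (B i φ).card) - 1)) := by
        refine avg_mono 𝒮.p_nonneg fun i φ hφ => ?_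
        have := neg_log_guess_le hw he (B i φ) (E i φ) (hB i φ hφ)
        rwa [div_eq_inv_mul _ w] at this
    _ = (Real.log w + Real.log (1 / (w * (𝒮.ε / 𝒮.W)))
          * avg 𝒮.p 𝒮.assignments (fun i φ => if φ s ∈ E i φ then 1 else 0))
        + ((w⁻¹ * avg 𝒮.p 𝒮.assignments (fun i φ => ((B i φ \ E i φ).card : ℝ))
          + 𝒮.ε / 𝒮.W * avg 𝒮.p 𝒮.assignments (fun i φ => ((B i φ).card : ℝ))) - 1) := by
        rw [avg_add, avg_add, avg_sub, avg_add, avg_const_mul, avg_const_mul, avg_const_mul,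
          avg_const 𝒮.sum_p 𝒮.assignments_nonempty, avg_const 𝒮.sum_p 𝒮.assignments_nonempty]
    _ ≤ (Real.log w + Real.log (𝒮.ρ / 𝒮.ε) * 𝒮.ε) + ((w⁻¹ * w + 𝒮.ε / 𝒮.W * 𝒮.W) - 1) := by
        have h1 := mul_le_mul_of_nonneg_right hlog hE0
        have h2 := mul_le_mul_of_nonneg_left hE (log_div_nonneg (𝒮 := 𝒮))
        have h3 := mul_le_mul_of_nonneg_left hBE (inv_pos.2 hw).le
        have h4 := mul_le_mul_of_nonneg_left hBW he.le
        linarith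
    _ = _ := by
        rw [inv_mul_cancel₀ hw.ne', div_mul_cancel₀ _ hW.ne', err]; ring

variable [Fintype U]

lemma predicts_empty : 𝒮.Predicts ∅ 0 fun _ _ _ => 1 where
  nonneg _ _ _ := zero_le_one
  sum_le _ _ g _ _ := by simp
  pos _ _ _ := zero_lt_one
  avg_le := by simp [avg]

/-- Predicting the keys in the slots `A` from sets `B` and `E` that are known once the keys outside
`A ∪ A'` are, and then predicting the keys in the slots `A'`. -/
lemma Predicts.union {A A' : Finset (Fin L)} (hAA : Disjoint A A') {κ w : ℝ}
    {Q : ι → Mem → (Fin L → U) → ℝ} (hQ : 𝒮.Predicts A' κ Q) (hw : 0 < w)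
    (hwW : 𝒮.W ≤ 𝒮.ρ * w) (B : ι → Mem → (Fin L → U) → Finset U)
    (E : ι → (Fin L → U) → Finset U)
    (hBdep : ∀ i s, DependsOn (B i s) (↑(A ∪ A'))ᶜ) (hEdep : ∀ i, DependsOn (E i) (↑(A ∪ A'))ᶜ)
    (hB : ∀ s ∈ A, ∀ i, ∀ φ ∈ 𝒮.assignments, φ s ∈ B i (𝒮.mem i φ) φ)
    (hE : ∀ s ∈ A, avg 𝒮.p 𝒮.assignments (fun i φ => if φ s ∈ E i φ then 1 else 0) ≤ 𝒮.ε)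
    (hBE : avg 𝒮.p 𝒮.assignments
      (fun i φ => ((B i (𝒮.mem i φ) φ \ E i φ).card : ℝ)) ≤ w)
    (hBW : avg 𝒮.p 𝒮.assignments (fun i φ => ((B i (𝒮.mem i φ) φ).card : ℝ)) ≤ 𝒮.W) :
    𝒮.Predicts (A ∪ A') (A.card * (Real.log w + 𝒮.err) + κ) fun i s φ =>
      (∏ j ∈ A, guess w (𝒮.ε / 𝒮.W) (B i s φ) (E i φ) (φ j)) * Q i s φ := by
  have he : 0 < 𝒮.ε / 𝒮.W := div_pos 𝒮.ε_pos 𝒮.W_pos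
  have hsubA : ((↑(A ∪ A') : Set (Fin L)))ᶜ ⊆ (↑A : Set (Fin L))ᶜ :=
    Set.compl_subset_compl.2 (by simp)
  have hsubA' : ((↑(A ∪ A') : Set (Fin L)))ᶜ ⊆ (↑A' : Set (Fin L))ᶜ :=
    Set.compl_subset_compl.2 (by simp)
  have hpos : ∀ i, ∀ φ ∈ 𝒮.assignments, ∀ j ∈ A,
      0 < guess w (𝒮.ε / 𝒮.W) (B i (𝒮.mem i φ) φ) (E i φ) (φ j) :=
    fun i φ hφ j hj => guess_pos hw he _ _ (hB j hj i φ hφ)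
  refine ⟨fun i s φ => ?_, fun i s g hg0 hg => ?_, fun i φ hφ => ?_, ?_⟩
  · exact mul_nonneg (Finset.prod_nonneg fun j _ => guess_nonneg hw he _ _ _) (hQ.nonneg i s φ)
  · have h0 : ∀ φ, 0 ≤ g φ * ∏ j ∈ A, guess w (𝒮.ε / 𝒮.W) (B i s φ) (E i φ) (φ j) :=
      fun φ => mul_nonneg (hg0 φ) (Finset.prod_nonneg fun j _ => guess_nonneg hw he _ _ _)
    have hdep : DependsOn
        (fun φ => g φ * ∏ j ∈ A, guess w (𝒮.ε / 𝒮.W) (B i s φ) (E i φ) (φ j)) (↑A')ᶜ := by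
      intro φ ψ h
      have e0 := hg (fun i hi => h i (hsubA' hi))
      have e1 := hBdep i s (fun i hi => h i (hsubA' hi))
      have e2 := hEdep i (fun i hi => h i (hsubA' hi))
      simp only [e0, e1, e2]
      congr 1
      refine Finset.prod_congr rfl fun j hj => ?_
      rw [h j (by simpa using Finset.disjoint_left.1 hAA hj)]
    have h1 := hQ.sum_le i s _ h0 hdep
    have h2 := card_pow_mul_sum_mul_prod_le A g hg0
      (fun φ ψ h => hg (fun i hi => h i (hsubA hi)))
      (fun φ => guess w (𝒮.ε / 𝒮.W) (B i s φ) (E i φ)) (fun φ x => guess_nonneg hw he _ _ _)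
      (fun φ ψ h => by
        have e1 := hBdep i s (fun i hi => h i (hsubA hi))
        have e2 := hEdep i (fun i hi => h i (hsubA hi))
        simp only [e1, e2])
      (fun φ => sum_guess_le_one _ _)
    rw [Finset.card_union_of_disjoint hAA, pow_add, mul_assoc]
    refine le_trans ?_ h2
    gcongr
    simpa only [mul_assoc] using h1
  · exact mul_pos (Finset.prod_pos (hpos i φ hφ)) (hQ.pos i φ hφ)
  · have e : avg 𝒮.p 𝒮.assignments (fun i φ => -Real.log
        ((∏ j ∈ A, guess w (𝒮.ε / 𝒮.W) (B i (𝒮.mem i φ) φ) (E i φ) (φ j)) * Q i (𝒮.mem i φ) φ))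
        = avg 𝒮.p 𝒮.assignments (fun i φ => (∑ j ∈ A,
            -Real.log (guess w (𝒮.ε / 𝒮.W) (B i (𝒮.mem i φ) φ) (E i φ) (φ j)))
          + -Real.log (Q i (𝒮.mem i φ) φ)) := by
      refine avg_congr fun i φ hφ => ?_
      rw [Real.log_mul (Finset.prod_pos (hpos i φ hφ)).ne' (hQ.pos i φ hφ).ne',
        Real.log_prod fun j hj => (hpos i φ hφ j hj).ne', Finset.sum_neg_distrib]
      ring
    rw [e, avg_add, avg_sum]
    refine add_le_add ?_ hQ.avg_le
    rw [← nsmul_eq_mul]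
    exact Finset.sum_le_card_nsmul _ _ _ fun j hj =>
      avg_neg_log_guess_le hw hwW j (fun i φ => B i (𝒮.mem i φ) φ) E (hB j hj) (hE j hj) hBE hBW

/-- The keys of consecutive blocks are predicted block by block. The next block is always the first
or the last unknown one; it is searched for in the difference of the late set after the last and
the early set before the first unknown block. -/
lemma exists_predicts_hidden (l a : ℕ) (h : a + l ≤ k) :
    ∃ Q, 𝒮.Predicts (𝒮.hidden a l)
      (b * (shrinkCost 𝒮.G l a + Real.log l.factorial + l * 𝒮.err)) Q := by
  induction l generalizing a with
  | zero => exact ⟨_, by simpa [hidden_zero, shrinkCost] using predicts_empty⟩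
  | succ l ih =>
    have hGpos : 0 < 𝒮.G (a + (l + 1)) - 𝒮.G a := sub_pos.2 (𝒮.G_strictMono (by omega))
    have hlog : Real.log (𝒮.G (a + (l + 1)) - 𝒮.G a)
        = logSlope 𝒮.G (l + 1) a + Real.log ((l + 1 : ℕ) : ℝ) := by
      rw [logSlope, Real.log_div hGpos.ne' (by positivity)]; ring
    have hfac : Real.log ((l + 1).factorial : ℝ)
        = Real.log ((l + 1 : ℕ) : ℝ) + Real.log (l.factorial : ℝ) := by
      rw [Nat.factorial_succ, Nat.cast_mul, Real.log_mul (by positivity) (by positivity)]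
    have step : ∀ j a', (a ≤ j ∧ j ≤ a + l) → 𝒮.hidden a (l + 1) = 𝒮.block j ∪ 𝒮.hidden a' l →
        Disjoint (𝒮.block j) (𝒮.hidden a' l) → a' + l ≤ k →
        ∃ Q, 𝒮.Predicts (𝒮.hidden a (l + 1)) (b * ((logSlope 𝒮.G (l + 1) a + shrinkCost 𝒮.G l a')
          + Real.log (l + 1).factorial + (l + 1 : ℕ) * 𝒮.err)) Q := by
      intro j a' hj hu hd ha'
      obtain ⟨Q, hQ⟩ := ih a' ha'
      have := hQ.union hd (w := 𝒮.G (a + (l + 1)) - 𝒮.G a) hGpos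
        (𝒮.W_le _ _ (by omega)) (𝒮.late (a + (l + 1))) (𝒮.early a)
        (fun i s φ ψ e => 𝒮.late_dependsOn _ i s fun s' hs' => e s' ?_)
        (fun i φ ψ e => 𝒮.early_dependsOn _ i fun s' hs' => e s' ?_)
        (fun s hs i φ hφ => 𝒮.mem_late i φ hφ j _ (by omega) h s
          (mem_block.1 hs).1 (mem_block.1 hs).2)
        (fun s hs => 𝒮.avg_mem_early_le a (by omega) s
          ((blk_mono hj.1).trans (mem_block.1 hs).1))
        (𝒮.avg_card_sdiff_le _ _ (by omega) h) (𝒮.avg_card_late_le _ h)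
      · rw [← hu, card_block (by omega : j < k), hlog] at this
        have e : (b : ℝ) * (logSlope 𝒮.G (l + 1) a + Real.log ((l + 1 : ℕ) : ℝ) + 𝒮.err)
            + b * (shrinkCost 𝒮.G l a' + Real.log l.factorial + l * 𝒮.err)
            = b * ((logSlope 𝒮.G (l + 1) a + shrinkCost 𝒮.G l a')
              + Real.log (l + 1).factorial + (l + 1 : ℕ) * 𝒮.err) := by
          rw [hfac]; push_cast; ring
        rw [e] at this
        exact ⟨_, this⟩
      · rw [← hu]
        intro hs
        have := lt_blk_of_mem_hidden (Finset.mem_coe.1 hs)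
        exact absurd hs' (not_le.2 this)
      · rw [← hu]
        intro hs
        have := blk_le_of_mem_hidden (Finset.mem_coe.1 hs)
        exact absurd hs' (not_lt.2 this)
    rw [shrinkCost]
    rcases min_choice (shrinkCost 𝒮.G l a) (shrinkCost 𝒮.G l (a + 1)) with hm | hm
    · rw [hm]
      exact step (a + l) a (by omega) (hidden_succ_right a l)
        (disjoint_block_hidden (.inr le_rfl)) (by omega)
    · rw [hm]
      exact step a (a + 1) (by omega) (hidden_succ_left a l)
        (disjoint_block_hidden (.inl (Nat.lt_succ_self a))) (by omega)

/-- The keys that are present can be predicted from the memory and the keys in the other slots. -/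
lemma exists_predicts :
    ∃ A Q, A.card = c + k * b ∧ 𝒮.Predicts A (c * (Real.log 𝒮.W + 𝒮.err)
      + b * (shrinkCost 𝒮.G k 0 + Real.log k.factorial + k * 𝒮.err)) Q := by
  obtain ⟨Q, hQ⟩ := exists_predicts_hidden (𝒮 := 𝒮) k 0 (by omega)
  have hd : Disjoint 𝒮.base (𝒮.hidden 0 k) := by
    rw [Finset.disjoint_left]
    intro s h1 h2
    have h1 : (s : ℕ) < c := (Finset.mem_filter.1 h1).2
    have := blk_le_of_mem_hidden h2
    have := 𝒮.le_blk_zero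
    omega
  have hlt : ∀ s ∈ 𝒮.base ∪ 𝒮.hidden 0 k, (s : ℕ) < 𝒮.blk k := by
    intro s hs
    rcases Finset.mem_union.1 hs with hs | hs
    · exact (Finset.mem_filter.1 hs).2.trans_le
        (𝒮.le_blk_zero.trans (blk_mono (Nat.zero_le k)))
    · simpa using lt_blk_of_mem_hidden hs
  -- The keys of the base are searched for in the whole accepted set: nothing is excluded.
  have := hQ.union hd 𝒮.W_pos (le_mul_of_one_le_left 𝒮.W_pos.le 𝒮.one_le_ρ)
    (𝒮.late k) (fun _ _ => ∅)
    (fun i s φ ψ e => 𝒮.late_dependsOn _ i s fun s' hs' => e s' ?_)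
    (fun i φ ψ e => rfl)
    (fun s hs i φ hφ => 𝒮.base_mem_late i φ hφ s (Finset.mem_filter.1 hs).2)
    (fun s hs => by simpa [avg] using 𝒮.ε_pos.le)
    (by simpa using 𝒮.avg_card_late_le k le_rfl) (𝒮.avg_card_late_le k le_rfl)
  · rw [card_base] at this
    refine ⟨_, _, ?_, this⟩
    rw [Finset.card_union_of_disjoint hd, card_base, card_hidden k 0 (by omega)]
  · intro hs
    exact absurd hs' (not_le.2 (hlt s' (Finset.mem_coe.1 hs)))

/-- If the memory has few states, then no prediction from it has a small loss. -/
lemma Predicts.le [Fintype Mem] [Nonempty U] {A : Finset (Fin L)} {κ : ℝ}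
    {Q : ι → Mem → (Fin L → U) → ℝ} (hQ : 𝒮.Predicts A κ Q) :
    A.card * Real.log (Fintype.card U) + Real.log 𝒮.assignments.card
      - L * Real.log (Fintype.card U) ≤ Real.log (Fintype.card Mem) + κ := by
  obtain ⟨φ₀, hφ₀⟩ := 𝒮.assignments_nonempty
  have hI : (0 : ℝ) < 𝒮.assignments.card := by
    exact_mod_cast 𝒮.assignments_nonempty.card_pos
  obtain ⟨i₀⟩ : Nonempty ι := by
    by_contra h
    rw [not_nonempty_iff] at h
    simpa using 𝒮.sum_p
  have hMem : (0 : ℝ) < Fintype.card Mem := by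
    exact_mod_cast Fintype.card_pos_iff.2 ⟨𝒮.mem i₀ φ₀⟩
  have hlogpow : Real.log ((Fintype.card U : ℝ) ^ A.card) = A.card * Real.log (Fintype.card U) :=
    Real.log_pow _ _
  have hU : (0 : ℝ) < Fintype.card U := by exact_mod_cast Fintype.card_pos
  set u : ℝ := (Fintype.card U : ℝ)
  have hsum : ∀ i, ∑ φ ∈ 𝒮.assignments, Q i (𝒮.mem i φ) φ
      ≤ Fintype.card Mem * (u ^ L / u ^ A.card) := by
    intro i
    calc _ ≤ ∑ φ ∈ 𝒮.assignments, ∑ s, Q i s φ :=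
          Finset.sum_le_sum fun φ _ =>
            Finset.single_le_sum (f := fun s => Q i s φ) (fun s _ => hQ.nonneg i s φ)
              (Finset.mem_univ _)
      _ ≤ ∑ φ, ∑ s, Q i s φ :=
          Finset.sum_le_sum_of_subset_of_nonneg (Finset.subset_univ _)
            fun φ _ _ => Finset.sum_nonneg fun s _ => hQ.nonneg i s φ
      _ = ∑ s, ∑ φ, Q i s φ := Finset.sum_comm
      _ ≤ ∑ _s : Mem, u ^ L / u ^ A.card := by
          refine Finset.sum_le_sum fun s _ => ?_
          rw [le_div_iff₀ (by positivity), mul_comm]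
          have := hQ.sum_le i s (fun _ => 1) (fun _ => zero_le_one) (fun _ _ _ => rfl)
          simpa [u] using this
      _ = _ := by simp
  set K : ℝ := Fintype.card Mem * (u ^ L / u ^ A.card) / 𝒮.assignments.card with hK
  have hKpos : 0 < K := by positivity
  have havg : avg 𝒮.p 𝒮.assignments (fun i φ => Q i (𝒮.mem i φ) φ) ≤ K := by
    calc _ = ∑ i, 𝒮.p i / 𝒮.assignments.card * ∑ φ ∈ 𝒮.assignments, Q i (𝒮.mem i φ) φ := by
          simp only [avg, Finset.mul_sum]
      _ ≤ ∑ i, 𝒮.p i / 𝒮.assignments.card * (Fintype.card Mem * (u ^ L / u ^ A.card)) :=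
          Finset.sum_le_sum fun i _ =>
            mul_le_mul_of_nonneg_left (hsum i) (div_nonneg (𝒮.p_nonneg i) hI.le)
      _ = K := by
          rw [← Finset.sum_mul, ← Finset.sum_div, 𝒮.sum_p, hK]; ring
  -- The tangent of the logarithm at `K` lies above the logarithm.
  have hlog : -Real.log K ≤ κ := by
    refine le_trans ?_ hQ.avg_le
    calc -Real.log K = -Real.log K + (1 - K⁻¹ * K) := by
          rw [inv_mul_cancel₀ hKpos.ne']; ring
      _ ≤ -Real.log K + (1 - K⁻¹ * avg 𝒮.p 𝒮.assignments (fun i φ => Q i (𝒮.mem i φ) φ)) := by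
          have := mul_le_mul_of_nonneg_left havg (inv_pos.2 hKpos).le
          linarith
      _ = avg 𝒮.p 𝒮.assignments (fun i φ =>
            -Real.log K + (1 - K⁻¹ * Q i (𝒮.mem i φ) φ)) := by
          rw [avg_add, avg_sub, avg_const_mul, avg_const 𝒮.sum_p 𝒮.assignments_nonempty,
            avg_const 𝒮.sum_p 𝒮.assignments_nonempty]
      _ ≤ _ := by
          refine avg_mono 𝒮.p_nonneg fun i φ hφ => ?_
          have hq := hQ.pos i φ hφ
          have := Real.log_le_sub_one_of_pos (mul_pos (inv_pos.2 hKpos) hq)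
          rw [Real.log_mul (inv_pos.2 hKpos).ne' hq.ne', Real.log_inv] at this
          linarith
  have hKlog : Real.log K = Real.log (Fintype.card Mem) + (L * Real.log u - A.card * Real.log u)
      - Real.log 𝒮.assignments.card := by
    rw [hK, Real.log_div (by positivity) hI.ne', Real.log_mul hMem.ne' (by positivity),
      Real.log_div (by positivity) (by positivity), Real.log_pow, Real.log_pow]
  rw [hKlog] at hlog
  linarith

end Scheme

/-! ### Replacing the tape by a finite family of tapes -/

section Tapes

variable {U : Type} {m : ℕ}

instance : IsProbabilityMeasure tapeLaw := by
  unfold tapeLaw; infer_instance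

/-- The deterministic algorithms. -/
abbrev DetAlgorithm (U : Type) (m : ℕ) : Type :=
  Memory m × (Memory m → U → Memory m) × (Memory m → U → Memory m) × (Memory m → U → Bool)

/-- The deterministic algorithm that results from fixing the tape. -/
def Algorithm.fixTape (D : Algorithm U m) (t : Tape) : DetAlgorithm U m :=
  (D.start t, D.ins t, D.del t, D.query t)

lemma Algorithm.measurable_fixTape (D : Algorithm U m) : Measurable D.fixTape := by
  refine D.measurable_start.prodMk (Measurable.prodMk ?_ (Measurable.prodMk ?_ ?_))
  · exact measurable_pi_iff.2 fun s => measurable_pi_iff.2 fun x => D.measurable_ins s x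
  · exact measurable_pi_iff.2 fun s => measurable_pi_iff.2 fun x => D.measurable_del s x
  · exact measurable_pi_iff.2 fun s => measurable_pi_iff.2 fun x => D.measurable_query s x

lemma Algorithm.query_run_congr (D : Algorithm U m) {t t' : Tape} (h : D.fixTape t = D.fixTape t')
    (σ : List (Op U)) (x : U) :
    D.query t (D.run t σ) x = D.query t' (D.run t' σ) x := by
  simp only [Algorithm.fixTape, Prod.mk.injEq] at h
  obtain ⟨h1, h2, h3, h4⟩ := h
  have hstep : D.step t = D.step t' := by
    funext s o
    cases o <;> simp [Algorithm.step, h2, h3]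
  simp only [Algorithm.run, hstep, h1, h4]

/-- For a finite universe there are finitely many deterministic algorithms, and a tape for each of
them represents the law of the tape. -/
lemma Algorithm.exists_finite_tapes [Finite U] (D : Algorithm U m) :
    ∃ (ι : Type) (_ : Fintype ι) (p : ι → ℝ) (t : ι → Tape), (∀ i, 0 ≤ p i) ∧ ∑ i, p i = 1 ∧
      ∀ (σ : List (Op U)) (x : U), tapeLaw.real {t : Tape | D.query t (D.run t σ) x = false}
        = ∑ i, if D.query (t i) (D.run (t i) σ) x = false then p i else 0 := by
  classical
  have : Fintype (DetAlgorithm U m) := Fintype.ofFinite _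
  have hm : ∀ d : DetAlgorithm U m, MeasurableSet (D.fixTape ⁻¹' {d}) :=
    fun d => D.measurable_fixTape (measurableSet_singleton d)
  let t : DetAlgorithm U m → Tape := fun d =>
    if h : ∃ t, D.fixTape t = d then h.choose else fun _ => false
  have ht : ∀ d, (∃ t, D.fixTape t = d) → D.fixTape (t d) = d := by
    intro d h
    simp only [t, dif_pos h]
    exact h.choose_spec
  refine ⟨DetAlgorithm U m, inferInstance, fun d => tapeLaw.real (D.fixTape ⁻¹' {d}), t,
    fun _ => measureReal_nonneg, ?_, fun σ x => ?_⟩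
  · rw [sum_measureReal_preimage_singleton _ fun d _ => hm d]
    simp
  · rw [← Finset.sum_filter, sum_measureReal_preimage_singleton _ fun d _ => hm d]
    congr 1
    ext t'
    have := D.query_run_congr (ht (D.fixTape t') ⟨t', rfl⟩) σ x
    simp [this]

end Tapes

/-! ### The error rate for a finite family of tapes -/

section Samples

lemma Algorithm.run_append {U : Type} {m : ℕ} (D : Algorithm U m) (t : Tape) (σ τ : List (Op U)) :
    D.run t (σ ++ τ) = τ.foldl (D.step t) (D.run t σ) := by
  simp [Algorithm.run]

variable {U : Type} [Fintype U] {m : ℕ}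

/-- The set of keys accepted in the memory state `s` with tape `t`. -/
def Algorithm.acceptedIn (D : Algorithm U m) (t : Tape) (s : Memory m) : Finset U :=
  Finset.univ.filter fun x => D.query t s x = true

lemma Algorithm.mem_acceptedIn {D : Algorithm U m} {t : Tape} {s : Memory m} {x : U} :
    x ∈ D.acceptedIn t s ↔ D.query t s x = true := by simp [Algorithm.acceptedIn]

variable [DecidableEq U]

/-- The finite family of tapes `t` with weights `p` has the false-positive error rate of a dynamic
filter. -/
structure Samples {ι : Type} [Fintype ι] (D : Algorithm U m) (n : ℕ) (ε : ℝ) (N : ℕ)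
    (p : ι → ℝ) (t : ι → Tape) : Prop where
  nonneg : ∀ i, 0 ≤ p i
  sum_eq_one : ∑ i, p i = 1
  sum_mem_le : ∀ σ : List (Op U), Admissible n N σ → ∀ x ∉ keySet σ,
    ∑ i, p i * (if x ∈ D.acceptedIn (t i) (D.run (t i) σ) then 1 else 0) ≤ ε

lemma Algorithm.IsDynamicFilter.exists_samples {D : Algorithm U m} {n N : ℕ} {ε : ℝ}
    (h : D.IsDynamicFilter n ε N) :
    ∃ (ι : Type) (_ : Fintype ι) (p : ι → ℝ) (t : ι → Tape), Samples D n ε N p t := by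
  obtain ⟨ι, _, p, t, hp, hp1, hq⟩ := D.exists_finite_tapes
  refine ⟨ι, inferInstance, p, t, hp, hp1, fun σ hσ x hx => ?_⟩
  have h1 := h.query_not_mem σ hσ x hx
  rw [hq] at h1
  have h2 : ∑ i, p i * (if x ∈ D.acceptedIn (t i) (D.run (t i) σ) then 1 else 0)
      + ∑ i, (if D.query (t i) (D.run (t i) σ) x = false then p i else 0) = 1 := by
    rw [← Finset.sum_add_distrib]
    refine (Finset.sum_congr rfl fun i _ => ?_).trans hp1
    cases hc : D.query (t i) (D.run (t i) σ) x <;> simp [Algorithm.mem_acceptedIn, hc]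
  linarith

lemma Samples.sum_card_le {ι : Type} [Fintype ι] {D : Algorithm U m} {n N : ℕ} {ε : ℝ}
    {p : ι → ℝ} {t : ι → Tape} (h : Samples D n ε N p t) (hε : 0 ≤ ε) {σ : List (Op U)}
    (hσ : Admissible n N σ) :
    ∑ i, p i * ((D.acceptedIn (t i) (D.run (t i) σ)).card : ℝ) ≤ n + ε * Fintype.card U := by
  have e : ∑ i, p i * ((D.acceptedIn (t i) (D.run (t i) σ)).card : ℝ)
      = ∑ x, ∑ i, p i * (if x ∈ D.acceptedIn (t i) (D.run (t i) σ) then 1 else 0) := by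
    rw [Finset.sum_comm]
    refine Finset.sum_congr rfl fun i _ => ?_
    rw [← Finset.mul_sum]
    simp
  rw [e]
  have hb : ∀ x, ∑ i, p i * (if x ∈ D.acceptedIn (t i) (D.run (t i) σ) then (1 : ℝ) else 0)
      ≤ (if x ∈ keySet σ then 1 else 0) + ε := by
    intro x
    by_cases hx : x ∈ keySet σ
    · rw [if_pos hx]
      have : ∑ i, p i * (if x ∈ D.acceptedIn (t i) (D.run (t i) σ) then (1 : ℝ) else 0)
          ≤ ∑ i, p i :=
        Finset.sum_le_sum fun i _ =>
          mul_le_of_le_one_right (h.nonneg i) (by split_ifs <;> norm_num)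
      rw [h.sum_eq_one] at this
      linarith
    · rw [if_neg hx, zero_add]
      exact h.sum_mem_le σ hσ x hx
  refine (Finset.sum_le_sum fun x _ => hb x).trans ?_
  have hcard : ((keySet σ).card : ℝ) ≤ n := by
    exact_mod_cast hσ.2.2 σ (List.prefix_refl σ)
  rw [Finset.sum_add_distrib]
  simp only [Finset.sum_ite_mem, Finset.univ_inter, Finset.sum_const, nsmul_eq_mul, mul_one,
    Finset.card_univ]
  linarith [mul_comm ε (Fintype.card U : ℝ)]

end Samples

/-! ### Assigning keys to slots -/

section Assign

variable {U : Type} [Nonempty U] {L : ℕ}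

/-- An assignment of keys to the slots below `L`, extended arbitrarily. -/
noncomputable def extend (φ : Fin L → U) (j : ℕ) : U :=
  if h : j < L then φ ⟨j, h⟩ else Classical.arbitrary U

/-- The operational sequence that arises by assigning keys to slots. -/
noncomputable def assign (φ : Fin L → U) (w : List (Op ℕ)) : List (Op U) :=
  w.map (Op.map (extend φ))

lemma extend_coe (φ : Fin L → U) (j : Fin L) : extend φ j = φ j := by
  simp [extend]

lemma injOn_extend {φ : Fin L → U} (hφ : Function.Injective φ) :
    Set.InjOn (extend φ) {j | j < L} := by
  intro i hi j hj h
  have hi : i < L := hi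
  have hj : j < L := hj
  simp only [extend, dif_pos hi, dif_pos hj] at h
  exact congrArg Fin.val (hφ h)

lemma assign_append (φ : Fin L → U) (w v : List (Op ℕ)) :
    assign φ (w ++ v) = assign φ w ++ assign φ v := List.map_append

lemma assign_congr {φ ψ : Fin L → U} {w : List (Op ℕ)}
    (h : ∀ o ∈ w, ∀ hL : o.key < L, φ ⟨o.key, hL⟩ = ψ ⟨o.key, hL⟩) : assign φ w = assign ψ w := by
  refine map_congr_of_key fun o ho => ?_
  unfold extend
  split_ifs with hL
  · exact h o ho hL
  · rfl

variable [DecidableEq U]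

lemma moves_assign {φ : Fin L → U} (hφ : Function.Injective φ) {n : ℕ} {w : List (Op ℕ)}
    {T : Finset ℕ} (h : Moves n ∅ w T) (hw : ∀ o ∈ w, o.key < L) :
    Moves n ∅ (assign φ w) (T.image (extend φ)) := by
  simpa [assign] using h.map (injOn_extend hφ) (by simp) hw

lemma selfContained_assign {φ : Fin L → U} (hφ : Function.Injective φ) {w : List (Op ℕ)}
    {n : ℕ} {T : Finset ℕ} (h : Moves n ∅ w T) (hw : ∀ o ∈ w, o.key < L) :
    SelfContained (assign φ w) :=
  (moves_assign hφ h hw).validFrom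

end Assign

/-! ### Decoding a monotone filter -/

section Accept

variable {U : Type} [Fintype U] [DecidableEq U] {m L : ℕ}

/-- The injective assignments of keys to the slots below `L`. -/
noncomputable def injections (U : Type) [Fintype U] [DecidableEq U] (L : ℕ) : Finset (Fin L → U) :=
  Finset.univ.filter Function.Injective

lemma mem_injections {φ : Fin L → U} : φ ∈ injections U L ↔ Function.Injective φ := by
  simp [injections]

lemma card_injections : (injections U L).card = (Fintype.card U).descFactorial L := by
  rw [injections, ← Fintype.card_subtype,
    Fintype.card_congr (Equiv.subtypeInjectiveEquivEmbedding (Fin L) U),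
    Fintype.card_embedding_eq, Fintype.card_fin]

variable [Nonempty U]

/-- The set of keys accepted after the sequence `w` of slots, whose keys are assigned by `φ`. -/
noncomputable def Algorithm.acceptedAfter (D : Algorithm U m) (w : List (Op ℕ)) (t : Tape)
    (φ : Fin L → U) : Finset U :=
  D.acceptedIn t (D.run t (assign φ w))

/-- The mean size of the accepted set after the sequence `w`, for random injective keys. -/
noncomputable def meanAccepted {ι : Type} [Fintype ι] (D : Algorithm U m) (p : ι → ℝ)
    (t : ι → Tape) (L : ℕ) (w : List (Op ℕ)) : ℝ :=
  avg p (injections U L) fun i φ => ((D.acceptedAfter w (t i) φ).card : ℝ)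

variable {D : Algorithm U m} {n N : ℕ} {ε : ℝ}

lemma Algorithm.IsMonotone.acceptedAfter_subset (h : D.IsMonotone n N) {w v : List (Op ℕ)}
    {φ : Fin L → U} (hφ : Function.Injective φ) (hw : w ≠ []) {T T' : Finset ℕ} {c : ℕ}
    (hwv : Moves n ∅ (w ++ v) T) (hN : (w ++ v).length ≤ N) (hv : Moves c ∅ v T')
    (hkey : ∀ o ∈ w ++ v, o.key < L) (t : Tape) :
    D.acceptedAfter w t φ ⊆ D.acceptedAfter (w ++ v) t φ := by
  rcases eq_or_ne v [] with rfl | hne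
  · rw [List.append_nil]
  intro x hx
  rw [Algorithm.acceptedAfter, Algorithm.mem_acceptedIn] at hx ⊢
  rw [assign_append]
  refine h (assign φ w) (assign φ v) (by simpa [assign] using hw) (by simpa [assign] using hne)
    ?_ ?_ t hx
  · rw [← assign_append]
    exact (moves_assign hφ hwv hkey).admissible (by simpa [assign] using hN)
  · exact selfContained_assign hφ hv fun o ho => hkey o (List.mem_append_right _ ho)

lemma Algorithm.IsDynamicFilter.mem_acceptedAfter (h : D.IsDynamicFilter n ε N) {w : List (Op ℕ)}
    {φ : Fin L → U} (hφ : Function.Injective φ) {T : Finset ℕ} (hw : Moves n ∅ w T)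
    (hN : w.length ≤ N) (hkey : ∀ o ∈ w, o.key < L) (t : Tape) {j : Fin L} (hj : (j : ℕ) ∈ T) :
    φ j ∈ D.acceptedAfter w t φ := by
  have hm := moves_assign hφ hw hkey
  rw [Algorithm.acceptedAfter, Algorithm.mem_acceptedIn]
  refine h.query_mem _ (hm.admissible (by simpa [assign] using hN)) _ ?_ t
  rw [hm.keySet_eq, ← extend_coe φ j]
  exact Finset.mem_image_of_mem _ hj

variable {ι : Type} [Fintype ι] {p : ι → ℝ} {t : ι → Tape}

lemma Samples.avg_mem_le (h : Samples D n ε N p t) (hL : L ≤ Fintype.card U)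
    {w : List (Op ℕ)} {T : Finset ℕ} (hw : Moves n ∅ w T) (hN : w.length ≤ N)
    (hkey : ∀ o ∈ w, o.key < L) (hT : ∀ x ∈ T, x < L) {j : Fin L} (hj : (j : ℕ) ∉ T) :
    avg p (injections U L) (fun i φ => if φ j ∈ D.acceptedAfter w (t i) φ then 1 else 0) ≤ ε := by
  refine avg_le_of_forall ?_ fun φ hφ => ?_
  · rw [← Finset.card_pos, card_injections]
    exact Nat.descFactorial_pos.2 hL
  have hφ := mem_injections.1 hφ
  have hm := moves_assign hφ hw hkey
  refine h.sum_mem_le _ (hm.admissible (by simpa [assign] using hN)) _ ?_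
  rw [hm.keySet_eq, ← extend_coe φ j]
  intro hmem
  obtain ⟨x, hx, e⟩ := Finset.mem_image.1 hmem
  exact hj (injOn_extend hφ (hT x hx) j.2 e ▸ hx)

lemma Samples.meanAccepted_le (h : Samples D n ε N p t) (hε : 0 ≤ ε) (hL : L ≤ Fintype.card U)
    {w : List (Op ℕ)} {T : Finset ℕ} (hw : Moves n ∅ w T) (hN : w.length ≤ N)
    (hkey : ∀ o ∈ w, o.key < L) :
    meanAccepted D p t L w ≤ n + ε * Fintype.card U := by
  refine avg_le_of_forall ?_ fun φ hφ => ?_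
  · rw [← Finset.card_pos, card_injections]
    exact Nat.descFactorial_pos.2 hL
  exact h.sum_card_le hε
    ((moves_assign (mem_injections.1 hφ) hw hkey).admissible (by simpa [assign] using hN))

lemma Samples.meanAccepted_nonneg (h : Samples D n ε N p t) (w : List (Op ℕ)) :
    0 ≤ meanAccepted D p t L w :=
  avg_nonneg h.nonneg fun _ _ _ => Nat.cast_nonneg _

lemma exists_lt_sub_le_div (f : ℕ → ℝ) (hf : 0 ≤ f 0) {R : ℕ} (hR : 0 < R) :
    ∃ x < R, f (x + 1) - f x ≤ f R / R := by
  by_contra! h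
  have h1 : ∑ _x ∈ Finset.range R, f R / R < ∑ x ∈ Finset.range R, (f (x + 1) - f x) :=
    Finset.sum_lt_sum_of_nonempty (by simpa using hR.ne') fun x hx =>
      h x (Finset.mem_range.1 hx)
  rw [Finset.sum_range_sub, Finset.sum_const, Finset.card_range, nsmul_eq_mul,
    mul_div_cancel₀ _ (by exact_mod_cast hR.ne')] at h1
  linarith

/-- At each level, one of the `R` iterations hardly enlarges the accepted set on average; the
execution is stopped during these iterations. -/
lemma Samples.exists_schedule (h : Samples D n ε N p t) (hε : 0 ≤ ε) {k b R c : ℕ} (hR : 0 < R)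
    (hn : c + k * b = n) (hN : 2 * (c + slots b R k) ≤ N)
    (hU : c + slots b R k ≤ Fintype.card U) :
    ∃ s : Schedule, s.k = k ∧ s.b = b ∧ s.R = R ∧ s.c = c ∧ s.Valid ∧
      ∀ i < s.k, meanAccepted D p t s.total (s.top i)
        ≤ meanAccepted D p t s.total (s.mid i) + (n + ε * Fintype.card U) / s.R := by
  let f : List (Op ℕ) → ℝ := meanAccepted D p t (c + slots b R k)
  obtain ⟨s, rfl, rfl, rfl, rfl, hs⟩ := Schedule.exists_schedule k b R c
    (fun i w o x => (i = k → x = 0) ∧ (i < k → x < R ∧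
      f (w ++ iterations b R (k - 1 - i) o 0 (x + 1)) - f (w ++ iterations b R (k - 1 - i) o 0 x)
        ≤ f (w ++ iterations b R (k - 1 - i) o 0 R) / R)) fun i w o => by
      by_cases hi : i < k
      · obtain ⟨x, hx, hle⟩ := exists_lt_sub_le_div
          (fun x => f (w ++ iterations b R (k - 1 - i) o 0 x)) (h.meanAccepted_nonneg _) hR
        exact ⟨x, fun h => absurd h hi.ne, fun _ => ⟨hx, hle⟩⟩
      · exact ⟨0, fun _ => rfl, fun h => absurd h hi⟩
  have hv : s.Valid := ⟨fun i hi => ((hs i).2 hi).1, (hs s.k).1 rfl⟩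
  refine ⟨s, rfl, rfl, rfl, rfl, hv, fun i hi => ?_⟩
  have h1 := ((hs i).2 hi).2
  have h2 : f (s.pre i ++ iterations s.b s.R (s.k - 1 - i) (s.off i) 0 s.R)
      ≤ n + ε * Fintype.card U := by
    refine h.meanAccepted_le hε hU (T := s.keys i) ?_ ?_ ?_
    · have := Schedule.moves_pre_append_iterations hv hi s.R
      rwa [show s.capacity = n from hn] at this
    · exact (Schedule.length_pre_append_iterations_le hv hi le_rfl).trans hN
    · exact Schedule.key_pre_append_iterations hv hi le_rfl
  rw [Schedule.top_of_lt hi]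
  have h3 := div_le_div_of_nonneg_right h2 (Nat.cast_nonneg (α := ℝ) s.R)
  change f _ ≤ f (s.pre i ++ iterations s.b s.R (s.k - 1 - i) (s.off i) 0 (s.r i)) + _
  linarith

end Accept

section Build

variable {U : Type} [Fintype U] [Nonempty U] {m : ℕ} {D : Algorithm U m} {s : Schedule}

/-- The set of keys accepted after the decoder has led the memory `st` back to level `a`. -/
noncomputable def lateAccepted (D : Algorithm U m) (s : Schedule) (a : ℕ) (t : Tape) (st : Memory m)
    (φ : Fin s.total → U) : Finset U :=
  D.acceptedIn t ((assign φ (s.down (s.k - a) a)).foldl (D.step t) st)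

lemma lateAccepted_run (hv : s.Valid) {a : ℕ} (ha : a ≤ s.k) (t : Tape) (φ : Fin s.total → U) :
    lateAccepted D s a t (D.run t (assign φ (s.top s.k))) φ = D.acceptedAfter (s.top a) t φ := by
  rw [lateAccepted, Algorithm.acceptedAfter, ← D.run_append, ← assign_append,
    Schedule.top_append_down hv _ _ (by omega)]

variable [DecidableEq U] {n N : ℕ} {ε : ℝ} {ι : Type} [Fintype ι] {p : ι → ℝ} {t : ι → Tape}

lemma acceptedAfter_mid_subset_mid (hmono : D.IsMonotone n N) (hv : s.Valid) (hn : s.capacity = n)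
    (hN : 2 * s.total ≤ N) (hc : 0 < s.c) {φ : Fin s.total → U} (hφ : Function.Injective φ)
    (t : Tape) {i j : ℕ} (hij : i ≤ j) (hj : j ≤ s.k) :
    D.acceptedAfter (s.mid i) t φ ⊆ D.acceptedAfter (s.mid j) t φ := by
  induction j, hij using Nat.le_induction with
  | base => exact subset_rfl
  | succ j hij ih =>
    refine (ih (by omega)).trans ?_
    obtain ⟨T, hT⟩ := Schedule.exists_moves_climb hv hj
    rw [Schedule.mid_succ]
    exact hmono.acceptedAfter_subset hφ (Schedule.mid_ne_nil hc j)
      (hn ▸ Schedule.mid_succ (s := s) j ▸ Schedule.moves_mid hv hj)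
      (Schedule.mid_succ (s := s) j ▸ (Schedule.length_mid_le hv hj).trans hN) hT
      (Schedule.mid_succ (s := s) j ▸ Schedule.key_mid_lt_total hv hj) t

lemma acceptedAfter_mid_subset_top (hmono : D.IsMonotone n N) (hv : s.Valid) (hn : s.capacity = n)
    (hN : 2 * s.total ≤ N) (hc : 0 < s.c) {φ : Fin s.total → U} (hφ : Function.Injective φ)
    (t : Tape) {i j : ℕ} (hij : i ≤ j) (hj : j ≤ s.k) :
    D.acceptedAfter (s.mid i) t φ ⊆ D.acceptedAfter (s.top j) t φ := by
  refine (acceptedAfter_mid_subset_mid hmono hv hn hN hc hφ t hij hj).trans ?_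
  rcases hj.eq_or_lt with rfl | hj'
  · rw [Schedule.top_last]
  · have e : s.top j = s.mid j ++ iteration s.b s.R (s.k - 1 - j) (s.blk j) := by
      rw [Schedule.top, if_pos hj']
    have h1 := Schedule.moves_top hv hj
    have h2 := Schedule.length_top_le hv hj
    have h3 := Schedule.key_top hv hj
    rw [e, hn] at h1
    rw [e] at h2 h3 ⊢
    exact hmono.acceptedAfter_subset hφ (Schedule.mid_ne_nil hc j) h1 (h2.trans hN)
      (moves_iteration (S := ∅) (by simp) le_rfl) h3 t

/-- The keys of a monotone filter that was stopped within the nested loops can be decoded: the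
decoder completes the loops and deletes known blocks, so that the accepted set hardly differs from
the one that it saw at the same level before. -/
lemma exists_scheme_of_schedule (h : Samples D n ε N p t) (hε : 0 < ε) (hε1 : ε ≤ 1)
    (hD : D.IsDynamicFilter n ε N) (hmono : D.IsMonotone n N) (hv : s.Valid) (hn : s.capacity = n)
    (hN : 2 * s.total ≤ N) (hc : 0 < s.c) (hR : 0 < s.R) (hU : s.total ≤ Fintype.card U)
    (hsel : ∀ i < s.k, meanAccepted D p t s.total (s.top i)
      ≤ meanAccepted D p t s.total (s.mid i) + (n + ε * Fintype.card U) / s.R) :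
    ∃ 𝒮 : Scheme ι U (Memory m) s.total s.k s.b s.c, 𝒮.ε = ε ∧ 𝒮.W = n + ε * Fintype.card U ∧
      𝒮.ρ = s.R ∧ 𝒮.assignments = injections U s.total ∧
      𝒮.G s.k - 𝒮.G 0 ≤ (n + ε * Fintype.card U) * (1 + s.k / s.R) := by
  set W : ℝ := n + ε * Fintype.card U with hW
  let F : ℕ → ℝ := fun i => meanAccepted D p t s.total (s.mid i)
  -- The summand `i * (W / s.R)` accounts for the growth of the accepted set in the iteration that
  -- the decoder completes, and it keeps the increments of `G` away from zero.
  let G : ℕ → ℝ := fun i => F (min i s.k) + i * (W / s.R)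
  have hR' : (1 : ℝ) ≤ s.R := by exact_mod_cast hR
  have hn0 : 0 < n := by rw [← hn, Schedule.capacity]; omega
  have hW0 : 0 < W := by
    have : (0 : ℝ) < n := by exact_mod_cast hn0
    positivity
  have hWR : 0 < W / s.R := by positivity
  have hF : ∀ i j, i ≤ j → j ≤ s.k → F i ≤ F j := fun i j hij hj =>
    avg_mono h.nonneg fun i' φ hφ => by
      exact_mod_cast Finset.card_le_card (acceptedAfter_mid_subset_mid hmono hv hn hN hc
        (mem_injections.1 hφ) (t i') hij hj)
  have hGdiff : ∀ i j, i < j → W / s.R ≤ G j - G i := by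
    intro i j hij
    have h1 := hF (min i s.k) (min j s.k) (by omega) (by omega)
    have h2 : (i : ℝ) + 1 ≤ j := by exact_mod_cast hij
    have h3 := mul_le_mul_of_nonneg_right h2 hWR.le
    simp only [G]
    linarith
  have htop : ∀ a ≤ s.k, meanAccepted D p t s.total (s.top a) ≤ W := fun a ha =>
    h.meanAccepted_le hε.le hU (hn ▸ Schedule.moves_top hv ha)
      ((Schedule.length_top_le hv ha).trans hN) (Schedule.key_top hv ha)
  have hlate : ∀ a ≤ s.k, avg p (injections U s.total) (fun i φ =>
      ((lateAccepted D s a (t i) (D.run (t i) (assign φ (s.top s.k))) φ).card : ℝ))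
      = meanAccepted D p t s.total (s.top a) := fun a ha =>
    avg_congr fun i φ _ => by rw [lateAccepted_run hv ha]
  refine ⟨{
    p := p
    assignments := injections U s.total
    mem := fun i φ => D.run (t i) (assign φ (s.top s.k))
    blk := s.blk
    early := fun a i φ => D.acceptedAfter (s.mid a) (t i) φ
    late := fun a i st φ => lateAccepted D s a (t i) st φ
    G := G
    ε := ε
    W := W
    ρ := s.R
    p_nonneg := h.nonneg
    sum_p := h.sum_eq_one
    assignments_nonempty := ?_
    le_blk_zero := Schedule.off_le_blk 0
    blk_add_le := fun j => Schedule.off_le_blk (j + 1)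
    blk_last_le := ?_
    early_dependsOn := ?_
    late_dependsOn := ?_
    ε_pos := hε
    W_pos := hW0
    G_strictMono := fun i j hij => by linarith [hGdiff i j hij]
    one_le_div := ?_
    W_le := ?_
    one_le_ρ := hR'
    base_mem_late := ?_
    mem_late := ?_
    avg_mem_early_le := ?_
    avg_card_sdiff_le := ?_
    avg_card_late_le := fun a ha => (hlate a ha).trans_le (htop a ha) },
    rfl, rfl, rfl, rfl, ?_⟩
  · rw [← Finset.card_pos, card_injections]
    exact Nat.descFactorial_pos.2 hU
  · rw [Schedule.blk, hv.r_last, Nat.zero_mul, Nat.add_zero]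
    exact Schedule.off_le_total hv le_rfl
  · intro a i φ ψ e
    exact congrArg (fun σ => D.acceptedIn (t i) (D.run (t i) σ))
      (assign_congr fun o ho hL => e _ (Schedule.key_mid ho))
  · intro a i st φ ψ e
    exact congrArg (fun σ => D.acceptedIn (t i) (σ.foldl (D.step (t i)) st))
      (assign_congr fun o ho hL => e _ (Schedule.key_down o ho))
  · rw [one_le_div hε]; linarith
  · intro a a' haa
    have := mul_le_mul_of_nonneg_left (hGdiff a a' haa) (by positivity : (0 : ℝ) ≤ s.R)
    rwa [mul_div_cancel₀ _ (by positivity)] at this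
  · intro i φ hφ j hj
    rw [lateAccepted_run hv le_rfl]
    refine hD.mem_acceptedAfter (mem_injections.1 hφ) (hn ▸ Schedule.moves_top hv le_rfl)
      ((Schedule.length_top_le hv le_rfl).trans hN) (Schedule.key_top hv le_rfl) (t i) ?_
    exact Schedule.keys_mono (Nat.zero_le s.k) (Finset.mem_range.2 hj)
  · intro i φ hφ j a hja ha j' h1 h2
    rw [lateAccepted_run hv ha]
    refine hD.mem_acceptedAfter (mem_injections.1 hφ) (hn ▸ Schedule.moves_top hv ha)
      ((Schedule.length_top_le hv ha).trans hN) (Schedule.key_top hv ha) (t i) ?_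
    exact Schedule.keys_mono hja
      (Finset.mem_union_right _ (Finset.mem_Ico.2 ⟨h1, h2⟩))
  · intro a ha j hj
    have hlt : ∀ x ∈ s.keys a, x < s.blk a :=
      fun x hx => (Schedule.keys_lt hx).trans_le (Schedule.off_le_blk a)
    refine h.avg_mem_le hU (hn ▸ Schedule.moves_mid hv ha.le)
      ((Schedule.length_mid_le hv ha.le).trans hN) (Schedule.key_mid_lt_total hv ha.le)
      (fun x hx => (Schedule.keys_lt hx).trans_le (Schedule.off_le_total hv ha.le))
      fun hmem => ?_
    have := hlt _ hmem
    omega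
  · intro a a' haa ha'
    have e : avg p (injections U s.total) (fun i φ =>
        ((lateAccepted D s a' (t i) (D.run (t i) (assign φ (s.top s.k))) φ
          \ D.acceptedAfter (s.mid a) (t i) φ).card : ℝ))
        = meanAccepted D p t s.total (s.top a') - F a := by
      rw [← hlate a' ha']
      simp only [F, meanAccepted]
      rw [← avg_sub]
      refine avg_congr fun i φ hφ => ?_
      rw [lateAccepted_run hv ha', Finset.cast_card_sdiff (acceptedAfter_mid_subset_top hmono hv hn
        hN hc (mem_injections.1 hφ) (t i) haa.le ha')]
    rw [e]
    have h2 : (a : ℝ) + 1 ≤ a' := by exact_mod_cast haa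
    have h3 := mul_le_mul_of_nonneg_right h2 hWR.le
    have hmin : min a' s.k = a' := min_eq_left ha'
    have hmin' : min a s.k = a := min_eq_left (haa.le.trans ha')
    simp only [G, hmin, hmin']
    rcases ha'.eq_or_lt with rfl | hlt
    · rw [Schedule.top_last]
      change F s.k - F a ≤ _
      linarith
    · have := hsel a' hlt
      change _ ≤ F a' + _ at this
      linarith
  · have h0 : 0 ≤ F 0 := h.meanAccepted_nonneg _
    have h1 : F s.k ≤ W := by
      have := htop s.k le_rfl
      rwa [Schedule.top_last] at this
    simp only [G, min_self, Nat.zero_min, Nat.cast_zero, zero_mul, add_zero]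
    have : W * (1 + s.k / s.R) = W + s.k * (W / s.R) := by ring
    linarith

/-- The space bound for a monotone dynamic filter, with explicit error terms, in natural units of
information. -/
theorem log_card_le (hε : 0 < ε) (hε1 : ε ≤ 1) (hD : D.IsDynamicFilter n ε N)
    (hmono : D.IsMonotone n N) {k b R c : ℕ} (hR : 0 < R) (hc : 0 < c) (hk : 0 < k)
    (hn : c + k * b = n) (hN : 2 * (c + slots b R k) ≤ N)
    (hU : c + slots b R k ≤ Fintype.card U) :
    n * Real.log (Fintype.card U)
        + Real.log ((Fintype.card U).descFactorial (c + slots b R k))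
        - (c + slots b R k : ℕ) * Real.log (Fintype.card U)
      ≤ m * Real.log 2 + n * Real.log (n + ε * Fintype.card U)
        + b * (k * Real.log ((1 + k / R) / k) + Real.log k.factorial)
        + n * (ε * Real.log (R / ε) + ε) := by
  obtain ⟨ι, _, p, t, hs⟩ := hD.exists_samples
  obtain ⟨s, rfl, rfl, rfl, rfl, hv, hsel⟩ := hs.exists_schedule hε.le hR hn hN hU
  obtain ⟨𝒮, e1, e2, e3, e4, hG⟩ :=
    exists_scheme_of_schedule hs hε hε1 hD hmono hv hn hN hc hR hU hsel
  obtain ⟨A, Q, hA, hQ⟩ := 𝒮.exists_predicts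
  have h1 := hQ.le
  have h2 := shrinkCost_le 𝒮.G_strictMono s.k 0
  have hk' : (0 : ℝ) < s.k := by exact_mod_cast hk
  have hR' : (0 : ℝ) < s.R := by exact_mod_cast hR
  have hn0 : (0 : ℝ) < n := by
    have : 0 < n := by omega
    exact_mod_cast this
  have hW : 0 < (n : ℝ) + ε * Fintype.card U := by positivity
  have h3 : logSlope 𝒮.G s.k 0
      ≤ Real.log (n + ε * Fintype.card U) + Real.log ((1 + s.k / s.R) / s.k) := by
    rw [← Real.log_mul hW.ne' (by positivity), logSlope, zero_add]
    refine Real.log_le_log (div_pos (sub_pos.2 (𝒮.G_strictMono hk)) hk') ?_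
    rw [← mul_div_assoc]
    gcongr
  have h4 : (s.b : ℝ) * shrinkCost 𝒮.G s.k 0
      ≤ s.b * (s.k * (Real.log (n + ε * Fintype.card U) + Real.log ((1 + s.k / s.R) / s.k))) := by
    gcongr
    exact h2.trans (by gcongr)
  have hcast : (n : ℝ) = s.c + s.k * s.b := by exact_mod_cast hn.symm
  have hcardA : (A.card : ℝ) = n := by rw [hA, hn]
  have hMem : Real.log (Fintype.card (Memory m) : ℝ) = m * Real.log 2 := by
    simp [Memory]
  rw [hcardA, e4, card_injections, hMem, e2, Scheme.err, e1, e3] at h1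
  change _ + _ - ((s.total : ℕ) : ℝ) * _ ≤ _
  refine h1.trans ?_
  have hsplit : ∀ X Y : ℝ, (n : ℝ) * X + n * Y = s.c * (X + Y) + s.b * (s.k * X + s.k * Y) := by
    intro X Y; rw [hcast]; ring
  have := hsplit (Real.log (n + ε * Fintype.card U)) (ε * Real.log (s.R / ε) + ε)
  linarith

end Build

/-! ### Asymptotics -/

lemma slots_eq_mul (b R h : ℕ) : slots b R h = b * slots 1 R h := by
  induction h with
  | zero => rfl
  | succ h ih => rw [slots, slots, ih]; ring

lemma log_factorial_le {k : ℕ} (hk : 0 < k) :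
    Real.log (k.factorial : ℝ) ≤ k * Real.log k - k + Real.log k + 1 := by
  induction k, hk using Nat.le_induction with
  | base => simp
  | succ k hk ih =>
    have hk' : (0 : ℝ) < k := by exact_mod_cast hk
    rw [Nat.factorial_succ, Nat.cast_mul, Real.log_mul (by positivity) (by positivity)]
    have h := Real.one_sub_inv_le_log_of_pos (x := ((k + 1 : ℕ) : ℝ) / k) (by positivity)
    rw [Real.log_div (by positivity) (by positivity)] at h
    have h2 : (((k + 1 : ℕ) : ℝ)) * (1 - (((k + 1 : ℕ) : ℝ) / k)⁻¹) = 1 := by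
      push_cast; field_simp; ring
    have h3 := mul_le_mul_of_nonneg_left h (Nat.cast_nonneg (α := ℝ) (k + 1))
    rw [h2] at h3
    push_cast at h3 ⊢
    linarith

lemma log_descFactorial_ge {u L : ℕ} (hu : 0 < u) (h : 2 * L ≤ u) :
    -(2 * (L : ℝ) ^ 2 / u) ≤ Real.log (u.descFactorial L) - L * Real.log u := by
  have hu' : (0 : ℝ) < u := by exact_mod_cast hu
  have hL : (2 : ℝ) * L ≤ u := by exact_mod_cast h
  have hpos : (0 : ℝ) < u - L := by linarith
  have h1 : ((u : ℝ) - L) ^ L ≤ u.descFactorial L := by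
    have h2 : ((u - L : ℕ) : ℝ) = u - L := Nat.cast_sub (by omega)
    rw [← h2]
    exact_mod_cast (Nat.pow_le_pow_left (by omega : u - L ≤ u + 1 - L) L).trans
      (Nat.pow_sub_le_descFactorial u L)
  have h2 := Real.log_le_log (by positivity) h1
  rw [Real.log_pow] at h2
  have h3 := Real.one_sub_inv_le_log_of_pos (x := ((u : ℝ) - L) / u) (by positivity)
  rw [Real.log_div hpos.ne' hu'.ne'] at h3
  have h4 : -(2 * (L : ℝ) / u) ≤ 1 - (((u : ℝ) - L) / u)⁻¹ := by
    have e : 1 - (((u : ℝ) - L) / u)⁻¹ = -((L : ℝ) / (u - L)) := by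
      field_simp; ring
    rw [e, neg_le_neg_iff, div_le_div_iff₀ hpos hu']
    nlinarith [Nat.cast_nonneg (α := ℝ) L]
  have h5 := mul_le_mul_of_nonneg_left (h4.trans h3) (Nat.cast_nonneg (α := ℝ) L)
  have e : (L : ℝ) * -(2 * (L : ℝ) / u) = -(2 * (L : ℝ) ^ 2 / u) := by ring
  rw [e] at h5
  linarith

/-- The space bound with `k` levels of `k ^ 2` iterations. -/
lemma le_log_two_mul {u m n N : ℕ} {ε : ℝ} {D : Algorithm (Fin u) m} (hε : 0 < ε) (hε1 : ε < 1)
    (hD : D.IsDynamicFilter n ε N) (hmono : D.IsMonotone n N) {k C : ℕ} (hk : 0 < k) (hn : 0 < n)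
    (hC : 1 + slots 1 (k ^ 2) k ≤ C) (hN : 2 * (C * n) ≤ N) (hu : 2 * (C * n) ≤ u) :
    (n : ℝ) * Real.log ε⁻¹ + n - n * ((Real.log k + 2) / k + (k * (n : ℝ)⁻¹
      + (2 * C ^ 2 + 1) * (n * ε⁻¹ / u) + ((2 * Real.log k + 1) * ε - ε * Real.log ε)))
      ≤ m * Real.log 2 := by
  -- Monotonicity only concerns nonempty sequences, so at least one key is left for the base.
  obtain ⟨b, hb⟩ : ∃ b, b = (n - 1) / k := ⟨_, rfl⟩
  have hkb : k * b ≤ n - 1 := hb ▸ Nat.mul_div_le _ _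
  have hkb' : n - 1 < k * b + k := by
    have := Nat.lt_mul_div_succ (n - 1) hk
    rwa [← hb, Nat.mul_succ] at this
  obtain ⟨c, hc⟩ : ∃ c, c + k * b = n := ⟨n - k * b, by omega⟩
  have hbn : b ≤ n := by
    have : b ≤ k * b := Nat.le_mul_of_pos_left b hk
    omega
  have hL : c + slots b (k ^ 2) k ≤ C * n := by
    rw [slots_eq_mul]
    calc _ ≤ n + n * slots 1 (k ^ 2) k :=
          Nat.add_le_add (by omega) (Nat.mul_le_mul_right _ hbn)
      _ = (1 + slots 1 (k ^ 2) k) * n := by ring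
      _ ≤ _ := Nat.mul_le_mul_right _ hC
  have hC1 : 1 ≤ C := by omega
  have hu0 : 0 < u := by
    have : 1 * 1 ≤ C * n := Nat.mul_le_mul hC1 hn
    omega
  have : Nonempty (Fin u) := ⟨⟨0, hu0⟩⟩
  have key := log_card_le hε hε1.le hD hmono (k := k) (b := b) (R := k ^ 2) (c := c) (by positivity)
    (by omega) hk hc (by omega) (by rw [Fintype.card_fin]; omega)
  rw [Fintype.card_fin] at key
  set L := c + slots b (k ^ 2) k with hLdef
  have hk' : (1 : ℝ) ≤ k := by exact_mod_cast hk
  have hn' : (0 : ℝ) < n := by exact_mod_cast hn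
  have hu' : (0 : ℝ) < u := by exact_mod_cast hu0
  have h1 := log_descFactorial_ge (u := u) (L := L) hu0 (by omega)
  have h2 : 2 * (L : ℝ) ^ 2 / u ≤ n * (2 * C ^ 2 * (n * ε⁻¹ / u)) := by
    have hLC : (L : ℝ) ≤ C * n := by exact_mod_cast hL
    calc 2 * (L : ℝ) ^ 2 / u ≤ 2 * ((C : ℝ) * n) ^ 2 / u := by gcongr
      _ = (n : ℝ) * (2 * (C : ℝ) ^ 2 * ((n : ℝ) * 1 / u)) := by ring
      _ ≤ _ := by
        gcongr
        exact (one_le_inv₀ hε).2 hε1.le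
  -- The true keys hardly contribute to the size of the accepted set, as `n = o(ε u)`.
  have h3 : Real.log (n + ε * u) ≤ Real.log ε + Real.log u + n * ε⁻¹ / u := by
    have e : (n : ℝ) + ε * u = ε * u * (1 + n * ε⁻¹ / u) := by field_simp; ring
    have hx : (0 : ℝ) < 1 + n * ε⁻¹ / u := by positivity
    rw [e, Real.log_mul (by positivity) hx.ne', Real.log_mul hε.ne' hu'.ne']
    have := Real.log_le_sub_one_of_pos hx
    linarith
  have h4 : k * Real.log ((1 + k / (k ^ 2 : ℕ)) / k) ≤ 1 - k * Real.log k := by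
    have e : (1 : ℝ) + k / (k ^ 2 : ℕ) = 1 + 1 / k := by push_cast; field_simp
    have hx : (0 : ℝ) < 1 + 1 / k := by positivity
    rw [e, Real.log_div hx.ne' (by positivity)]
    have := mul_le_mul_of_nonneg_left (Real.log_le_sub_one_of_pos hx) (by positivity : (0 : ℝ) ≤ k)
    have e2 : (k : ℝ) * (1 + 1 / k - 1) = 1 := by field_simp; ring
    rw [e2] at this
    linarith
  have h5 := log_factorial_le hk
  have h6 : (b : ℝ) * (k * Real.log ((1 + k / (k ^ 2 : ℕ)) / k) + Real.log k.factorial)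
      ≤ n * ((Real.log k + 2) / k) + k - n := by
    have hlogk : 0 ≤ Real.log k := Real.log_nonneg hk'
    have hkb1 : (k : ℝ) * b ≤ n := by
      have : k * b ≤ n := by omega
      exact_mod_cast this
    have hkb2 : (n : ℝ) ≤ k * b + k := by
      have : n ≤ k * b + k := by omega
      exact_mod_cast this
    have hb1 : (b : ℝ) ≤ n / k := by
      rw [le_div_iff₀ (by positivity)]; linarith
    calc _ ≤ (b : ℝ) * (Real.log k + 2 - k) := by gcongr; linarith
      _ = b * (Real.log k + 2) - k * b := by ring
      _ ≤ n / k * (Real.log k + 2) - (n - k) := by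
        have := mul_le_mul_of_nonneg_right hb1 (by positivity : 0 ≤ Real.log k + 2)
        linarith
      _ = _ := by ring
  have h7 : ε * Real.log ((k ^ 2 : ℕ) / ε) + ε = (2 * Real.log k + 1) * ε - ε * Real.log ε := by
    rw [Real.log_div (by positivity) hε.ne', Nat.cast_pow, Real.log_pow]
    push_cast; ring
  rw [h7] at key
  have h8 := mul_le_mul_of_nonneg_left h3 hn'.le
  have h9 : (n : ℝ) * (k * (n : ℝ)⁻¹) = k := by field_simp
  rw [Real.log_inv]
  have e : (n : ℝ) * -Real.log ε + n - n * ((Real.log k + 2) / k + (k * (n : ℝ)⁻¹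
      + (2 * C ^ 2 + 1) * (n * ε⁻¹ / u) + ((2 * Real.log k + 1) * ε - ε * Real.log ε)))
      = -(n * Real.log ε) + n - n * ((Real.log k + 2) / k) - n * (k * (n : ℝ)⁻¹)
        - n * (2 * C ^ 2 * (n * ε⁻¹ / u)) - n * (n * ε⁻¹ / u)
        - n * ((2 * Real.log k + 1) * ε - ε * Real.log ε) := by ring
  rw [e, h9]
  linarith

lemma exists_log_add_two_div_le {δ : ℝ} (hδ : 0 < δ) :
    ∃ k : ℕ, 0 < k ∧ (Real.log k + 2) / k ≤ δ := by
  have h1 : Tendsto (fun k : ℕ => (Real.log k + 2) / (k : ℝ)) atTop (nhds 0) := by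
    have h : Tendsto (fun x : ℝ => (Real.log x + 2) / x) atTop (nhds 0) := by
      have := (Real.isLittleO_log_id_atTop.tendsto_div_nhds_zero).add
        ((tendsto_const_nhds (x := (2 : ℝ))).div_atTop tendsto_id)
      simpa [add_div] using this
    exact h.comp tendsto_natCast_atTop_atTop
  obtain ⟨k, hk, hk'⟩ := ((h1.eventually_le_const hδ).and (eventually_gt_atTop 0)).exists
  exact ⟨k, hk', hk⟩

variable {ε : ℕ → ℝ} {u N : ℕ → ℕ}

lemma eventually_le_bits (hε : ∀ n, 0 < ε n ∧ ε n < 1)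
    (hε_lim : Tendsto ε atTop (nhds 0))
    (hu : (fun n : ℕ => (n : ℝ) * (ε n)⁻¹) =o[atTop] fun n : ℕ => (u n : ℝ))
    (hN : (fun n : ℕ => (n : ℝ)) =o[atTop] fun n : ℕ => (N n : ℝ)) {δ : ℝ} (hδ : 0 < δ) :
    ∀ᶠ n in atTop, ∀ (m : ℕ) (D : Algorithm (Fin (u n)) m),
      D.IsDynamicFilter n (ε n) (N n) → D.IsMonotone n (N n) →
        (n : ℝ) * Real.logb 2 (ε n)⁻¹ + (n : ℝ) * Real.logb 2 (Real.exp 1) - δ * n ≤ m := by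
  have hlog2 : 0 < Real.log 2 := Real.log_pos one_lt_two
  have hδ' : 0 < δ * Real.log 2 / 2 := by positivity
  obtain ⟨k, hk, hkδ⟩ := exists_log_add_two_div_le hδ'
  set C := 1 + slots 1 (k ^ 2) k with hC
  have hCpos : (0 : ℝ) < 2 * C := by
    have : 0 < C := by omega
    positivity
  have hT : Tendsto (fun n : ℕ => k * (n : ℝ)⁻¹ + (2 * C ^ 2 + 1) * (n * (ε n)⁻¹ / u n)
      + ((2 * Real.log k + 1) * ε n - ε n * Real.log (ε n))) atTop (nhds 0) := by
    have t1 : Tendsto (fun n : ℕ => (n : ℝ)⁻¹) atTop (nhds 0) :=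
      tendsto_inv_atTop_zero.comp tendsto_natCast_atTop_atTop
    have t2 := hu.tendsto_div_nhds_zero
    have t3 : Tendsto (fun n => ε n * Real.log (ε n)) atTop (nhds 0) := by
      have := (Real.continuous_mul_log.tendsto 0).comp hε_lim
      rwa [zero_mul] at this
    have := ((t1.const_mul (k : ℝ)).add (t2.const_mul (2 * (C : ℝ) ^ 2 + 1))).add
      ((hε_lim.const_mul (2 * Real.log k + 1)).sub t3)
    simpa using this
  have hu2 := hu.def (inv_pos.2 hCpos)
  have hN2 := hN.def (inv_pos.2 hCpos)
  filter_upwards [hT.eventually_le_const hδ', hu2, hN2, eventually_gt_atTop 0]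
    with n h1 h2 h3 hn m D hD hmono
  have hn' : (0 : ℝ) < n := by exact_mod_cast hn
  obtain ⟨hε0, hε1⟩ := hε n
  rw [Real.norm_of_nonneg (by positivity), Real.norm_of_nonneg (by positivity),
    ← div_eq_inv_mul, le_div_iff₀ hCpos] at h2 h3
  have hNn : 2 * (C * n) ≤ N n := by
    have : (2 * (C * n) : ℝ) ≤ N n := by linarith
    exact_mod_cast this
  have hun : 2 * (C * n) ≤ u n := by
    have h4 : (n : ℝ) * 1 ≤ n * (ε n)⁻¹ := by
      gcongr
      exact (one_le_inv₀ hε0).2 hε1.le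
    have : (2 * (C * n) : ℝ) ≤ u n := by nlinarith
    exact_mod_cast this
  have key := le_log_two_mul hε0 hε1 hD hmono hk hn hC.ge hNn hun
  have h5 : (n : ℝ) * ((Real.log k + 2) / k + (k * (n : ℝ)⁻¹
      + (2 * C ^ 2 + 1) * (n * (ε n)⁻¹ / u n)
      + ((2 * Real.log k + 1) * ε n - ε n * Real.log (ε n)))) ≤ n * (δ * Real.log 2) := by
    gcongr; linarith
  have h6 : (n : ℝ) * Real.log (ε n)⁻¹ + n - n * (δ * Real.log 2) ≤ m * Real.log 2 := by linarith
  rw [Real.logb, Real.logb, Real.log_exp]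
  rw [← mul_le_mul_iff_left₀ hlog2]
  calc _ = (n : ℝ) * Real.log (ε n)⁻¹ + n - n * (δ * Real.log 2) := by field_simp
    _ ≤ _ := h6

end DynamicFilter

theorem mainTheorem4 (ε : ℕ → ℝ) (u N : ℕ → ℕ)
    (hε : ∀ n, 0 < ε n ∧ ε n < 1)
    (hε_lim : Tendsto ε atTop (nhds 0))
    (hu : (fun n : ℕ => (n : ℝ) * (ε n)⁻¹) =o[atTop] fun n : ℕ => (u n : ℝ))
    (hN : (fun n : ℕ => (n : ℝ)) =o[atTop] fun n : ℕ => (N n : ℝ)) :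
    ∃ g : ℕ → ℝ, (g =o[atTop] fun n : ℕ => (n : ℝ)) ∧
      ∀ (n m : ℕ) (D : DynamicFilter.Algorithm (Fin (u n)) m),
        D.IsDynamicFilter n (ε n) (N n) → D.IsMonotone n (N n) →
          (n : ℝ) * Real.logb 2 (ε n)⁻¹ + (n : ℝ) * Real.logb 2 (Real.exp 1) - g n ≤ (m : ℝ) := by
  classical
  -- The least space of such a filter; `g` is what this lacks to the main terms.
  let S : ℕ → Set ℕ := fun n => {m | ∃ D : DynamicFilter.Algorithm (Fin (u n)) m,
    D.IsDynamicFilter n (ε n) (N n) ∧ D.IsMonotone n (N n)}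
  let T : ℕ → ℝ := fun n => (n : ℝ) * Real.logb 2 (ε n)⁻¹ + (n : ℝ) * Real.logb 2 (Real.exp 1)
  refine ⟨fun n => if (S n).Nonempty then max 0 (T n - (sInf (S n) : ℕ)) else 0, ?_,
    fun n m D hD hmono => ?_⟩
  · rw [isLittleO_iff]
    intro δ hδ
    filter_upwards [DynamicFilter.eventually_le_bits hε hε_lim hu hN hδ] with n hn
    rw [Real.norm_of_nonneg (Nat.cast_nonneg n)]
    have h0 : 0 ≤ δ * n := by positivity
    split_ifs with hS
    · obtain ⟨D, hD, hmono⟩ := Nat.sInf_mem hS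
      have := hn _ D hD hmono
      rw [Real.norm_of_nonneg (le_max_left _ _)]
      exact max_le h0 (by simp only [T]; linarith)
    · simpa using h0
  · have hS : m ∈ S n := ⟨D, hD, hmono⟩
    have h1 : ((sInf (S n) : ℕ) : ℝ) ≤ m := by exact_mod_cast Nat.sInf_le hS
    have h2 := le_max_right 0 (T n - (sInf (S n) : ℕ))
    simp only [if_pos (show (S n).Nonempty from ⟨m, hS⟩)]
    change T n - _ ≤ _
    linarith
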